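/- Let $m\ge 2$ and let $T_m$ be the $m$-adic rooted tree, whose vertices are the finite words over an alphabet of $m$ letters. Let $\mathrm{Aut}\,T_m$ be the group of graph automorphisms of $T_m$ fixing the root, with the congruence topology, in which the level stabilizers $\mathrm{St}(n)$ (the subgroups fixing all words of length $n$) form a basis of neighbourhoods of the identity; closures $\overline{\,\cdot\,}$ are taken in this topology. For $g\in\mathrm{Aut}\,T_m$ and a vertex $v$, the section $g|_v\in\mathrm{Aut}\,T_m$ is the automorphism with $g(vu)=g(v)\,g|_v(u)$ for all words $u$, and $\psi(g)=(g|_{x})_{x}$, for $g\in \mathrm{St}(1)$, is the tuple of the sections at the $m$ vertices of the first level. A subgroup $G\le\mathrm{Aut}\,T_m$ is *weakly regular branch over* a subgroup $K\le G$ if $G$ is self-similar (that is, $g|_v\in G$ for all $g\in G$ and all vertices $v$), $G$ acts transitively on every level of the tree, $K\neq 1$, and $\psi(\mathrm{St}(1)\cap K)\ge K\times\overset{m}{\cdots}\times K$. For closed subgroups $H\le\Gamma\le\mathrm{Aut}\,T_m$ put $\Gamma_n=\mathrm{St}(n)\cap\Gamma$ and $$\mathrm{hdim}_\Gamma(H)=\liminf_{n\to\infty}\frac{\log|H\Gamma_n:\Gamma_n|}{\log|\Gamma:\Gamma_n|}.$$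 We say that $\Gamma$ has *complete bounded Hausdorff spectrum with respect to the level stabilizers* if there is a natural number $b\ge 1$ such that the set of the values $\mathrm{hdim}_\Gamma(H)$, where $H$ ranges over the closed subgroups of $\Gamma$ that are topologically generated by at most $b$ elements, is the whole interval $[0,1]$. **Corollary.** Let $G\le\mathrm{Aut}\,T_m$ be weakly regular branch over a finitely generated normal subgroup $K\trianglelefteq G$ with $\mathrm{hdim}_{\overline G}(\overline K)=1$. Then $\overline G$ has complete bounded Hausdorff spectrum with respect to the level stabilizers. This applies to the Basilica group $\mathcal B=\langle a,b\rangle\le\mathrm{Aut}\,T_2$, where $\psi(a)=(1,b)$ and $\psi(b)=(1,a)\sigma$ with $\sigma=(1\,2)$, that is, over the alphabet $\{0,1\}$, $a(0u)=0u$, $a(1u)=1\,b(u)$, $b(0u)=1u$, $b(1u)=0\,a(u)$: the group $\mathcal B$ is weakly regular branch over its commutator subgroup $\mathcal B'$, which is normal in $\mathcal B$, finitely generated, and satisfies $\mathrm{hdim}_{\overline{\mathcal B}}(\overline{\mathcal B'})=1$. Hence $\overline{\mathcal B}$ has complete bounded Hausdorff spectrum with respect to the level stabilizers. -/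

import Mathlib

open Filter

namespace RegTree

/-- The `m`-adic tree: its vertices are the finite words over an alphabet with `m` letters, and two
words are joined by an edge when one of them arises from the other by appending one letter. -/
def tree (m : ℕ) : SimpleGraph (List (Fin m)) where
  Adj u v := (∃ x, v = u ++ [x]) ∨ (∃ x, u = v ++ [x])
  symm := ⟨fun _ _ h => h.symm⟩
  loopless := ⟨fun u h => by
    rcases h with ⟨x, h⟩ | ⟨x, h⟩ <;> simpa using congrArg List.length h⟩

/-- The graph automorphisms of the `m`-adic tree that fix the root. -/
def rootedAut (m : ℕ) : Subgroup (tree m ≃g tree m) where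
  carrier := {g | g [] = []}
  one_mem' := rfl
  mul_mem' := by
    intro f g hf hg
    change f (g []) = []
    rw [show g [] = [] from hg]
    exact hf
  inv_mem' := by
    intro f hf
    change f.symm [] = []
    rw [RelIso.symm_apply_eq]
    exact (show f [] = [] from hf).symm

/-- The group `Aut T_m`. Automorphisms act on the left and `f * g` means first `g`, then `f`; for
the notions below this makes no difference to right actions composed from left to right. -/
abbrev AutT (m : ℕ) : Type := ↥(rootedAut m)

variable {m : ℕ}

/-- The image of the vertex `v` under the automorphism `g`. -/
def act (g : AutT m) (v : List (Fin m)) : List (Fin m) := g.1 v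

theorem act_one (v : List (Fin m)) : act 1 v = v := rfl

theorem act_mul (f g : AutT m) (v : List (Fin m)) : act (f * g) v = act f (act g v) := rfl

theorem act_inv_act (g : AutT m) (v : List (Fin m)) : act g⁻¹ (act g v) = v := by
  rw [← act_mul, inv_mul_cancel, act_one]

theorem act_act_inv (g : AutT m) (v : List (Fin m)) : act g (act g⁻¹ v) = v := by
  rw [← act_mul, mul_inv_cancel, act_one]

theorem act_injective (g : AutT m) : Function.Injective (act g) := fun u v h => by
  rw [← act_inv_act g u, h, act_inv_act]

theorem act_nil (g : AutT m) : act g [] = [] := g.2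

theorem act_ext {f g : AutT m} (h : ∀ v, act f v = act g v) : f = g :=
  Subtype.ext (RelIso.ext h)

theorem act_adj (g : AutT m) {u v : List (Fin m)} (h : (tree m).Adj u v) :
    (tree m).Adj (act g u) (act g v) := (RelIso.map_rel_iff g.1).2 h

theorem act_concat (g : AutT m) (v : List (Fin m)) :
    ∀ x, ∃ y, act g (v ++ [x]) = act g v ++ [y] := by
  induction v using List.reverseRecOn with
  | nil =>
    intro x
    have h : (tree m).Adj (act g []) (act g ([] ++ [x])) := act_adj g (Or.inl ⟨x, rfl⟩)
    rcases h with h | ⟨y, h⟩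
    · exact h
    · rw [act_nil] at h
      simp at h
  | append_singleton w z ih =>
    intro x
    obtain ⟨y, hy⟩ := ih z
    have h : (tree m).Adj (act g (w ++ [z])) (act g (w ++ [z] ++ [x])) :=
      act_adj g (Or.inl ⟨x, rfl⟩)
    rcases h with h | ⟨y', h⟩
    · exact h
    · exfalso
      rw [hy] at h
      have h1 : act g w = act g (w ++ [z] ++ [x]) := (List.append_inj' h rfl).1
      have h2 := congrArg List.length (act_injective g h1)
      simp at h2

theorem act_append (g : AutT m) (v u : List (Fin m)) :
    ∃ w, w.length = u.length ∧ act g (v ++ u) = act g v ++ w := by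
  induction u using List.reverseRecOn with
  | nil => exact ⟨[], rfl, by simp⟩
  | append_singleton u x ih =>
    obtain ⟨w, hl, hw⟩ := ih
    obtain ⟨y, hy⟩ := act_concat g (v ++ u) x
    exact ⟨w ++ [y], by simp [hl], by rw [← List.append_assoc, hy, hw, List.append_assoc]⟩

theorem length_act (g : AutT m) (v : List (Fin m)) : (act g v).length = v.length := by
  obtain ⟨w, hl, hw⟩ := act_append g [] v
  rw [act_nil] at hw
  simpa [hl] using congrArg List.length hw

/-- A permutation of the words which fixes the empty word and which, like its inverse, maps words
with one letter appended to words with one letter appended, as an element of `Aut T_m`. -/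
def ofPerm (e : Equiv.Perm (List (Fin m))) (h0 : e [] = [])
    (h : ∀ v x, ∃ y, e (v ++ [x]) = e v ++ [y])
    (h' : ∀ v x, ∃ y, e.symm (v ++ [x]) = e.symm v ++ [y]) : AutT m :=
  ⟨{ toEquiv := e
     map_rel_iff' := by
      have key : ∀ u v, (∃ x, e v = e u ++ [x]) ↔ ∃ x, v = u ++ [x] := by
        intro u v
        constructor
        · rintro ⟨x, hx⟩
          obtain ⟨y, hy⟩ := h' (e u) x
          refine ⟨y, ?_⟩
          rw [← hx] at hy
          simpa using hy
        · rintro ⟨x, rfl⟩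
          exact h u x
      intro u v
      exact or_congr (key u v) (key v u) }, h0⟩

theorem append_drop_act (g : AutT m) (v u : List (Fin m)) :
    act g (v ++ u) = act g v ++ (act g (v ++ u)).drop v.length := by
  obtain ⟨w, -, hw⟩ := act_append g v u
  rw [hw, ← length_act g v, List.drop_left]

theorem append_drop_act_inv (g : AutT m) (v u : List (Fin m)) :
    act g⁻¹ (act g v ++ u) = v ++ (act g⁻¹ (act g v ++ u)).drop v.length := by
  have := append_drop_act g⁻¹ (act g v) u
  rwa [act_inv_act, length_act] at this

/-- The section `g|_v` of `g` at the vertex `v`: the automorphism determined by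
`g (v u) = g (v) g|_v (u)` for all words `u`. -/
def sectionAt (g : AutT m) (v : List (Fin m)) : AutT m :=
  ofPerm
    { toFun := fun u => (act g (v ++ u)).drop v.length
      invFun := fun u => (act g⁻¹ (act g v ++ u)).drop v.length
      left_inv := fun u => by
        dsimp only
        rw [← append_drop_act, act_inv_act, List.drop_left]
      right_inv := fun u => by
        dsimp only
        rw [← append_drop_act_inv, act_act_inv, ← length_act g v, List.drop_left] }
    (by simp [← length_act g v])
    (fun u x => by
      obtain ⟨y, hy⟩ := act_concat g (v ++ u) x
      refine ⟨y, ?_⟩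
      change (act g (v ++ (u ++ [x]))).drop v.length = (act g (v ++ u)).drop v.length ++ [y]
      rw [← List.append_assoc, hy, List.drop_append_of_le_length]
      simp [length_act])
    (fun u x => by
      obtain ⟨y, hy⟩ := act_concat g⁻¹ (act g v ++ u) x
      refine ⟨y, ?_⟩
      change (act g⁻¹ (act g v ++ (u ++ [x]))).drop v.length =
        (act g⁻¹ (act g v ++ u)).drop v.length ++ [y]
      rw [← List.append_assoc, hy, List.drop_append_of_le_length]
      simp [length_act])

theorem act_append_section (g : AutT m) (v u : List (Fin m)) :
    act g (v ++ u) = act g v ++ act (sectionAt g v) u :=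
  append_drop_act g v u

/-- The `n`-th level stabilizer `St(n)` of `Aut T_m`. -/
def levelStab (m n : ℕ) : Subgroup (AutT m) where
  carrier := {g | ∀ v : List (Fin m), v.length = n → act g v = v}
  one_mem' := fun _ _ => rfl
  mul_mem' := by
    intro f g hf hg v hv
    rw [act_mul, hg v hv, hf v hv]
  inv_mem' := by
    intro f hf v hv
    apply act_injective f
    rw [act_act_inv, hf v hv]

instance levelStab_normal (m n : ℕ) : (levelStab m n).Normal where
  conj_mem := by
    intro g hg h v hv
    rw [act_mul, act_mul, hg _ (by rw [length_act, hv]), act_act_inv]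

theorem levelStab_anti {n k : ℕ} (hnk : n ≤ k) : levelStab m k ≤ levelStab m n := by
  intro g hg v hv
  cases v with
  | nil => exact act_nil g
  | cons x l =>
    have h := hg ((x :: l) ++ List.replicate (k - n) x) (by
      rw [List.length_append, List.length_replicate, hv]; omega)
    obtain ⟨w, -, hw⟩ := act_append g (x :: l) (List.replicate (k - n) x)
    rw [hw] at h
    exact (List.append_inj h (length_act g _)).1

/-- The level stabilizers, as a basis of neighbourhoods of the identity. -/
@[reducible] def congruenceBasis (m : ℕ) : GroupFilterBasis (AutT m) where
  sets := {U | ∃ n, U = (levelStab m n : Set (AutT m))}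
  nonempty := ⟨_, 0, rfl⟩
  inter_sets := by
    rintro _ _ ⟨n, rfl⟩ ⟨k, rfl⟩
    exact ⟨_, ⟨max n k, rfl⟩, fun g hg =>
      ⟨levelStab_anti (le_max_left n k) hg, levelStab_anti (le_max_right n k) hg⟩⟩
  one' := by
    rintro _ ⟨n, rfl⟩
    exact (levelStab m n).one_mem
  mul' := by
    rintro _ ⟨n, rfl⟩
    refine ⟨_, ⟨n, rfl⟩, ?_⟩
    rintro _ ⟨f, hf, g, hg, rfl⟩
    exact (levelStab m n).mul_mem hf hg
  inv' := by
    rintro _ ⟨n, rfl⟩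
    exact ⟨_, ⟨n, rfl⟩, fun g hg => (levelStab m n).inv_mem hg⟩
  conj' := by
    rintro h _ ⟨n, rfl⟩
    exact ⟨_, ⟨n, rfl⟩, fun g hg => (levelStab_normal m n).conj_mem g hg h⟩

/-- The congruence topology on `Aut T_m`. -/
instance congruenceTopology (m : ℕ) : TopologicalSpace (AutT m) := (congruenceBasis m).topology

instance autT_isTopologicalGroup (m : ℕ) : IsTopologicalGroup (AutT m) :=
  (congruenceBasis m).isTopologicalGroup

/-- `G` is self-similar: all sections of elements of `G` lie in `G`. -/
def IsSelfSimilar (G : Subgroup (AutT m)) : Prop :=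
  ∀ g ∈ G, ∀ v, sectionAt g v ∈ G

/-- `G` acts transitively on every level of the tree. -/
def IsLevelTransitive (G : Subgroup (AutT m)) : Prop :=
  ∀ u v : List (Fin m), u.length = v.length → ∃ g ∈ G, act g u = v

/-- `K` is branching: `ψ(St_K(1)) ≥ K × ⋯ × K`, that is, every `m`-tuple of elements of `K` is the
tuple of first-level sections of an element of `K` that fixes the first level. -/
def IsBranching (K : Subgroup (AutT m)) : Prop :=
  ∀ k : Fin m → AutT m, (∀ x, k x ∈ K) → ∃ g ∈ levelStab m 1 ⊓ K, ∀ x, sectionAt g [x] = k x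

/-- `G` is a weakly regular branch group, branching over its subgroup `K`. -/
structure IsWeaklyRegularBranchOver (G K : Subgroup (AutT m)) : Prop where
  selfSimilar : IsSelfSimilar G
  levelTransitive : IsLevelTransitive G
  le : K ≤ G
  ne_bot : K ≠ ⊥
  branching : IsBranching K

/-- The Hausdorff dimension of a closed subgroup `H` of `Γ` in the closed subgroup `Γ` of `Aut T_m`,
with respect to the level stabilizers `Γₙ = St_Γ(n)`:
`liminf log |H Γₙ : Γₙ| / log |Γ : Γₙ|`. The base of the logarithms cancels. -/
noncomputable def hdim (Γ H : Subgroup (AutT m)) : ℝ :=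
  liminf (fun n : ℕ =>
    Real.log ((levelStab m n ⊓ Γ).relIndex (H ⊔ (levelStab m n ⊓ Γ))) /
      Real.log ((levelStab m n ⊓ Γ).relIndex Γ)) atTop

/-- `H` is topologically generated by at most `b` elements. -/
def IsTopGeneratedBy (b : ℕ) (H : Subgroup (AutT m)) : Prop :=
  ∃ S : Finset (AutT m), S.card ≤ b ∧ (Subgroup.closure (S : Set (AutT m))).topologicalClosure = H

/-- The `b`-bounded Hausdorff spectrum of `Γ` with respect to the level stabilizers: the Hausdorff
dimensions of those closed subgroups of `Γ` that are topologically generated by at most `b`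
elements. -/
def boundedSpectrum (b : ℕ) (Γ : Subgroup (AutT m)) : Set ℝ :=
  {d | ∃ H : Subgroup (AutT m), H ≤ Γ ∧ IsClosed (H : Set (AutT m)) ∧ IsTopGeneratedBy b H ∧
    hdim Γ H = d}

/-- `Γ` has complete bounded Hausdorff spectrum with respect to the level stabilizers. -/
def HasCompleteBoundedSpectrum (Γ : Subgroup (AutT m)) : Prop :=
  ∃ b : ℕ, 1 ≤ b ∧ boundedSpectrum b Γ = Set.Icc 0 1

/-- The actions on words of the generators `a` (for `true`) and `b` (for `false`) of the Basilica
group: `a (0u) = 0u`, `a (1u) = 1 b(u)`, `b (0u) = 1u`, `b (1u) = 0 a(u)`. -/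
def basilicaFun : Bool → List (Fin 2) → List (Fin 2)
  | _, [] => []
  | true, x :: u => if x = 0 then 0 :: u else 1 :: basilicaFun false u
  | false, x :: u => if x = 0 then 1 :: u else 0 :: basilicaFun true u

/-- The inverses of the two maps `basilicaFun true` and `basilicaFun false`. -/
def basilicaInv : Bool → List (Fin 2) → List (Fin 2)
  | _, [] => []
  | true, x :: u => if x = 0 then 0 :: u else 1 :: basilicaInv false u
  | false, x :: u => if x = 0 then 1 :: basilicaInv true u else 0 :: u

theorem basilicaInv_basilicaFun (u : List (Fin 2)) :
    ∀ c, basilicaInv c (basilicaFun c u) = u := by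
  induction u with
  | nil => intro c; cases c <;> rfl
  | cons x u ih =>
    intro c
    cases c <;> fin_cases x <;> simp [basilicaFun, basilicaInv, ih]

theorem basilicaFun_basilicaInv (u : List (Fin 2)) :
    ∀ c, basilicaFun c (basilicaInv c u) = u := by
  induction u with
  | nil => intro c; cases c <;> rfl
  | cons x u ih =>
    intro c
    cases c <;> fin_cases x <;> simp [basilicaFun, basilicaInv, ih]

theorem basilicaFun_concat (u : List (Fin 2)) (x : Fin 2) :
    ∀ c, ∃ y, basilicaFun c (u ++ [x]) = basilicaFun c u ++ [y] := by
  induction u with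
  | nil => intro c; cases c <;> fin_cases x <;> simp [basilicaFun]
  | cons z u ih =>
    intro c
    obtain ⟨y, hy⟩ := ih true
    obtain ⟨y', hy'⟩ := ih false
    cases c <;> fin_cases z <;> simp [basilicaFun, hy, hy']

theorem basilicaInv_concat (u : List (Fin 2)) (x : Fin 2) :
    ∀ c, ∃ y, basilicaInv c (u ++ [x]) = basilicaInv c u ++ [y] := by
  induction u with
  | nil => intro c; cases c <;> fin_cases x <;> simp [basilicaInv]
  | cons z u ih =>
    intro c
    obtain ⟨y, hy⟩ := ih true
    obtain ⟨y', hy'⟩ := ih false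
    cases c <;> fin_cases z <;> simp [basilicaInv, hy, hy']

/-- The generators of the Basilica group as automorphisms of the binary tree. -/
def basilicaGen (c : Bool) : AutT 2 :=
  ofPerm
    { toFun := basilicaFun c
      invFun := basilicaInv c
      left_inv := fun u => basilicaInv_basilicaFun u c
      right_inv := fun u => basilicaFun_basilicaInv u c }
    (by cases c <;> rfl)
    (fun u x => basilicaFun_concat u x c)
    (fun u x => basilicaInv_concat u x c)

/-- The Basilica group: the subgroup of `Aut T_2` generated by `a` and `b`, where
`ψ(a) = (1, b)` and `ψ(b) = (1, a) σ`. -/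
def basilica : Subgroup (AutT 2) := Subgroup.closure {basilicaGen true, basilicaGen false}

end RegTree

namespace RegTree

open Topology
open scoped commutatorElement

variable {m : ℕ}

/-! Write `logCard n A` for the logarithm of the number of classes of `A` modulo St(n). Branching
gives `m * logCard n K ≤ logCard (n + 1) K`, while all of Aut T_m has `logCard` at most a multiple
of `m ^ n`; so `logCard n K / m ^ n` increases to some `c > 0` (`IsBranching.exists_growth`). The
closure of `G` has the same constant because `K` has dimension 1 in it, and so does `⁅K, K⁆`: modulo
St(n) the abelianization of `K` has bounded rank and exponent at most exponential in `n`, so only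
O(n) is lost (`levelCard_le_commutator`).

The base `m` digits of `d` yield a prefix-free set `V` with ∑ m^(-|v|) = d
(`exists_isPrefixFree_hasSum`). The product of copies of `K` at `V` has growth `d * c`, but `V` may
be infinite and boundedly many generators are wanted. It suffices that `H` lies between this product
and the product of copies of `⁅K, K⁆` on the level `N v` below each `v`
(`tendsto_logCard_of_placeSub`): the `m ^ N v` copies down there grow like one copy at `v`.

Such an `H` is generated by diagonal copies over `V` of the generators `s` of `K`, and by elements
with `s` below each `v` at all words of length `N v` ending in `p`, for the words `p` of a fixed
length `l` and for partners `q ≠ p` in the same `K`-orbit. The levels `N v` are distinct. Some `h`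
in `K` takes `y q` to `h(y) p` for one prescribed `y` only, among the levels that matter modulo
St(n) (`exists_act_eq_only_at`). Conjugating by the diagonal copy of `h` and taking commutators
isolates one vertex (`commutator_tail`), and diagonal copies of `K` enlarge the result to `⁅K, K⁆`
at that vertex (`singleHom_mem`). The number of generators depends on `K` and `l` only, not on `d`.

For the Basilica group, c = a⁻¹b⁻¹ab = (b, b⁻¹), and (1, c) is a commutator, which gives branching;
c, (c, 1) and (1, c) generate a normal subgroup. Dimension 1 is again the O(n) bound. -/

/-! ### Sections, closures and congruence modulo level stabilizers. -/

theorem act_inv_eq_iff (g : AutT m) {u v : List (Fin m)} : act g⁻¹ u = v ↔ u = act g v :=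
  ⟨fun h => by rw [← h, act_act_inv], fun h => by rw [h, act_inv_act]⟩

theorem act_sectionAt_eq_iff (g : AutT m) {v u w : List (Fin m)} :
    act (sectionAt g v) u = w ↔ act g (v ++ u) = act g v ++ w := by
  rw [act_append_section, List.append_cancel_left_eq]

theorem sectionAt_append (g : AutT m) (u v : List (Fin m)) :
    sectionAt g (u ++ v) = sectionAt (sectionAt g u) v := by
  apply act_ext
  intro w
  rw [act_sectionAt_eq_iff, List.append_assoc, act_append_section g u (v ++ w),
    act_append_section g u v, act_append_section (sectionAt g u) v w, List.append_assoc]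

theorem sectionAt_mul (f g : AutT m) (v : List (Fin m)) :
    sectionAt (f * g) v = sectionAt f (act g v) * sectionAt g v := by
  apply act_ext
  intro w
  rw [act_sectionAt_eq_iff, act_mul, act_mul, act_mul, act_append_section g,
    act_append_section f]

theorem sectionAt_one (v : List (Fin m)) : sectionAt (1 : AutT m) v = 1 := by
  apply act_ext
  intro w
  rw [act_sectionAt_eq_iff]
  rfl

theorem sectionAt_inv (g : AutT m) (v : List (Fin m)) :
    sectionAt g⁻¹ v = (sectionAt g (act g⁻¹ v))⁻¹ := by
  rw [eq_inv_iff_mul_eq_one, ← sectionAt_one v, ← inv_mul_cancel g⁻¹, inv_inv, sectionAt_mul,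
    ← sectionAt_mul, mul_inv_cancel, sectionAt_one, ← sectionAt_one (act g⁻¹ v),
    ← inv_mul_cancel g, sectionAt_mul, act_act_inv]

theorem sectionAt_nil (g : AutT m) : sectionAt g [] = g := by
  apply act_ext
  intro w
  rw [act_sectionAt_eq_iff, act_nil]
  rfl

theorem levelStab_zero : levelStab m 0 = ⊤ := by
  rw [eq_top_iff]
  intro g _ v hv
  rw [List.length_eq_zero_iff.1 hv, act_nil]

theorem act_of_mem_levelStab {g : AutT m} {n : ℕ} (hg : g ∈ levelStab m n)
    {v : List (Fin m)} (hv : v.length ≤ n) : act g v = v :=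
  levelStab_anti hv hg v rfl

theorem inv_mul_mem_levelStab {g h : AutT m} {n : ℕ} :
    g⁻¹ * h ∈ levelStab m n ↔ ∀ v : List (Fin m), v.length = n → act g v = act h v := by
  refine forall₂_congr fun v _ => ?_
  rw [act_mul, act_inv_eq_iff, eq_comm]

theorem mem_topologicalClosure_iff (A : Subgroup (AutT m)) (g : AutT m) :
    g ∈ A.topologicalClosure ↔
      ∀ n, ∃ a ∈ A, ∀ v : List (Fin m), v.length = n → act g v = act a v := by
  have hb := (congruenceBasis m).nhds_hasBasis g
  change g ∈ _root_.closure (A : Set (AutT m)) ↔ _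
  rw [mem_closure_iff_nhds_basis' hb]
  constructor
  · intro H n
    obtain ⟨_, ⟨z, hz, rfl⟩, hy⟩ := H (levelStab m n : Set (AutT m)) ⟨n, rfl⟩
    refine ⟨_, hy, inv_mul_mem_levelStab.1 ?_⟩
    simpa using hz
  · rintro H _ ⟨n, rfl⟩
    obtain ⟨a, ha, h⟩ := H n
    exact ⟨a, ⟨g⁻¹ * a, inv_mul_mem_levelStab.2 h, by simp⟩, ha⟩

/-- This is the form in which elements of `H` are found modulo St(n): agreement on level `n`
suffices. -/
theorem mem_sup_levelStab_iff (A : Subgroup (AutT m)) (n : ℕ) (g : AutT m) :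
    g ∈ A ⊔ levelStab m n ↔ ∃ a ∈ A, ∀ v : List (Fin m), v.length = n → act a v = act g v := by
  rw [← SetLike.mem_coe, Subgroup.mul_normal, Set.mem_mul]
  constructor
  · rintro ⟨a, ha, z, hz, rfl⟩
    exact ⟨a, ha, inv_mul_mem_levelStab.1 (by simpa using hz)⟩
  · rintro ⟨a, ha, h⟩
    exact ⟨a, ha, a⁻¹ * g, inv_mul_mem_levelStab.2 h, by simp⟩

/-! ### Automorphisms with prescribed sections -/

open Classical in
/-- Apply `f w` below the shortest prefix `w` that lies in `W`. -/
noncomputable def placeFun :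
    Set (List (Fin m)) → (List (Fin m) → AutT m) → List (Fin m) → List (Fin m)
  | _, _, [] => []
  | W, f, x :: u =>
    if [] ∈ W then act (f []) (x :: u)
    else x :: placeFun {w | x :: w ∈ W} (fun w => f (x :: w)) u

theorem placeFun_of_nil_mem {W : Set (List (Fin m))} (hW : [] ∈ W) (f : List (Fin m) → AutT m)
    (u : List (Fin m)) : placeFun W f u = act (f []) u := by
  cases u with
  | nil => rw [act_nil, placeFun]
  | cons x u => rw [placeFun, if_pos hW]

theorem placeFun_cons {W : Set (List (Fin m))} (hW : [] ∉ W) (f : List (Fin m) → AutT m)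
    (x : Fin m) (u : List (Fin m)) :
    placeFun W f (x :: u) = x :: placeFun {w | x :: w ∈ W} (fun w => f (x :: w)) u := by
  rw [placeFun, if_neg hW]

theorem placeFun_one (W : Set (List (Fin m))) (u : List (Fin m)) : placeFun W 1 u = u := by
  induction u generalizing W with
  | nil => rw [placeFun]
  | cons x u ih =>
    by_cases hW : [] ∈ W
    · rw [placeFun_of_nil_mem hW]; rfl
    · rw [placeFun_cons hW]; exact congrArg _ (ih _)

theorem placeFun_mul (W : Set (List (Fin m))) (f g : List (Fin m) → AutT m)
    (u : List (Fin m)) : placeFun W (f * g) u = placeFun W f (placeFun W g u) := by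
  induction u generalizing W f g with
  | nil => simp [placeFun]
  | cons x u ih =>
    by_cases hW : [] ∈ W
    · simp only [placeFun_of_nil_mem hW]; rfl
    · simp only [placeFun_cons hW]; exact congrArg _ (ih _ _ _)

theorem placeFun_concat (W : Set (List (Fin m))) (f : List (Fin m) → AutT m)
    (v : List (Fin m)) (x : Fin m) : ∃ y, placeFun W f (v ++ [x]) = placeFun W f v ++ [y] := by
  induction v generalizing W f with
  | nil =>
    by_cases hW : [] ∈ W
    · simp only [placeFun_of_nil_mem hW]; exact act_concat _ _ _
    · refine ⟨x, ?_⟩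
      rw [List.nil_append, placeFun_cons hW]; simp [placeFun]
  | cons z v ih =>
    by_cases hW : [] ∈ W
    · simp only [placeFun_of_nil_mem hW]; exact act_concat _ _ _
    · obtain ⟨y, hy⟩ := ih {w | z :: w ∈ W} (fun w => f (z :: w))
      refine ⟨y, ?_⟩
      rw [List.cons_append, placeFun_cons hW, placeFun_cons hW, hy, List.cons_append]

/-- The automorphism with section `f w` at every minimal word `w` of `W`, as a homomorphism in
the family `f`. -/
noncomputable def placeHom (W : Set (List (Fin m))) : (List (Fin m) → AutT m) →* AutT m where
  toFun f := ofPerm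
    { toFun := placeFun W f
      invFun := placeFun W f⁻¹
      left_inv := fun u => by rw [← placeFun_mul, inv_mul_cancel, placeFun_one]
      right_inv := fun u => by rw [← placeFun_mul, mul_inv_cancel, placeFun_one] }
    (by simp [placeFun]) (placeFun_concat W f) (placeFun_concat W f⁻¹)
  map_one' := act_ext (placeFun_one W)
  map_mul' f g := act_ext (placeFun_mul W f g)

theorem placeHom_of_nil_mem {W : Set (List (Fin m))} (hW : [] ∈ W) (f : List (Fin m) → AutT m) :
    placeHom W f = f [] :=
  act_ext (placeFun_of_nil_mem hW f)

theorem act_placeHom_cons {W : Set (List (Fin m))} (hW : [] ∉ W) (f : List (Fin m) → AutT m)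
    (x : Fin m) (u : List (Fin m)) : act (placeHom W f) (x :: u) =
      x :: act (placeHom {w | x :: w ∈ W} (fun w => f (x :: w))) u :=
  placeFun_cons hW f x u

/-- No word of `W` is a proper prefix of another one. -/
def IsPrefixFree (W : Set (List (Fin m))) : Prop := ∀ v ∈ W, ∀ w ∈ W, v <+: w → v = w

theorem act_placeHom_append {W : Set (List (Fin m))} (hW : IsPrefixFree W)
    (f : List (Fin m) → AutT m) {w : List (Fin m)} (hw : w ∈ W) (u : List (Fin m)) :
    act (placeHom W f) (w ++ u) = w ++ act (f w) u := by
  induction w generalizing W f with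
  | nil => rw [placeHom_of_nil_mem hw]; rfl
  | cons x w ih =>
    have h0 : [] ∉ W := fun h => by simpa using hW _ h _ hw List.nil_prefix
    rw [List.cons_append, act_placeHom_cons h0, List.cons_append]
    refine congrArg _ (ih (W := {w | x :: w ∈ W}) ?_ _ hw)
    intro v hv v' hv' h
    simpa using hW _ hv _ hv' ((List.prefix_cons_inj x).2 h)

/-- Words of length at most `n` do not see members of `W` of length `n` or more, since no letter is
left below them. So an infinite `W` is finite modulo St(n). -/
theorem act_placeHom_congr {n : ℕ} {W W' : Set (List (Fin m))} {f f' : List (Fin m) → AutT m}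
    (hW : ∀ w, w.length < n → (w ∈ W ↔ w ∈ W'))
    (hf : ∀ w ∈ W, w.length < n → ∀ u : List (Fin m), w.length + u.length ≤ n →
      act (f w) u = act (f' w) u) (u : List (Fin m)) (hu : u.length ≤ n) :
    act (placeHom W f) u = act (placeHom W' f') u := by
  induction u generalizing n W W' f f' with
  | nil => rw [act_nil, act_nil]
  | cons x u ih =>
    rw [List.length_cons] at hu
    by_cases h0 : [] ∈ W
    · rw [placeHom_of_nil_mem h0, placeHom_of_nil_mem ((hW [] (by simp; omega)).1 h0)]
      exact hf [] h0 (by simp; omega) _ (by simp; omega)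
    · have h0' : [] ∉ W' := fun h => h0 ((hW [] (by simp; omega)).2 h)
      rw [act_placeHom_cons h0, act_placeHom_cons h0']
      refine congrArg _ (ih (n := n - 1) ?_ ?_ (by omega))
      · intro w hw
        exact hW (x :: w) (by simp; omega)
      · intro w hw hwn v hv
        exact hf (x :: w) hw (by simp; omega) v (by simp; omega)

/-- Branching applied once per level; this needs the depth of `W` to be bounded. -/
theorem IsBranching.placeHom_mem {K : Subgroup (AutT m)} (hK : IsBranching K) {n : ℕ}
    {W : Set (List (Fin m))} (hW : ∀ w ∈ W, w.length ≤ n) {f : List (Fin m) → AutT m}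
    (hf : ∀ w ∈ W, f w ∈ K) : placeHom W f ∈ K := by
  induction n generalizing W f with
  | zero =>
    by_cases h0 : [] ∈ W
    · rw [placeHom_of_nil_mem h0]; exact hf _ h0
    · have : placeHom W f = 1 := by
        apply act_ext
        intro u
        have hn : ∀ w, w ∉ W := fun w hw => h0 (by
          have := hW w hw
          rwa [List.length_eq_zero_iff.1 (by omega : w.length = 0)] at hw)
        rw [act_placeHom_congr (n := u.length) (W' := W) (f' := 1) (fun _ _ => Iff.rfl)
          (fun w hw => absurd hw (hn w)) u le_rfl, map_one]
      rw [this]; exact K.one_mem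
  | succ n ih =>
    by_cases h0 : [] ∈ W
    · rw [placeHom_of_nil_mem h0]; exact hf _ h0
    · obtain ⟨g, ⟨hg1, hgK⟩, hg⟩ := hK
        (fun x => placeHom {w | x :: w ∈ W} (fun w => f (x :: w))) (fun x =>
          ih (W := {w | x :: w ∈ W}) (fun w hw => by simpa using hW _ hw) (fun w hw => hf _ hw))
      have : placeHom W f = g := by
        apply act_ext
        intro u
        cases u with
        | nil => rw [act_nil, act_nil]
        | cons x u =>
          rw [act_placeHom_cons h0, ← hg x, ← List.singleton_append (l := u),
            act_append_section, hg1 [x] rfl]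
          rfl
      rw [this]; exact hgK

/-- Truncations of `W` at length `n` give elements of `K` that agree with the given one on level
`n`. -/
theorem IsBranching.placeHom_mem_closure {K : Subgroup (AutT m)} (hK : IsBranching K)
    (W : Set (List (Fin m))) {f : List (Fin m) → AutT m} (hf : ∀ w ∈ W, f w ∈ K) :
    placeHom W f ∈ K.topologicalClosure := by
  rw [mem_topologicalClosure_iff]
  intro n
  refine ⟨placeHom {w ∈ W | w.length ≤ n} f,
    hK.placeHom_mem (fun w hw => hw.2) (fun w hw => hf w hw.1), fun u hu => ?_⟩
  exact act_placeHom_congr (n := n) (fun w hw => (and_iff_left hw.le).symm)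
    (fun _ _ _ _ _ => rfl) u hu.le

/-! ### Prescribed sections on one level -/

/-- The automorphism fixing the words of length `N` with prescribed sections there. -/
noncomputable def levHom (m N : ℕ) : (List (Fin m) → AutT m) →* AutT m :=
  placeHom {w | w.length = N}

theorem isPrefixFree_length (N : ℕ) : IsPrefixFree {w : List (Fin m) | w.length = N} :=
  fun _ hv _ hw h => h.eq_of_length (hv.trans hw.symm)

theorem act_levHom_append {N : ℕ} (f : List (Fin m) → AutT m) {w : List (Fin m)}
    (hw : w.length = N) (u : List (Fin m)) : act (levHom m N f) (w ++ u) = w ++ act (f w) u :=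
  act_placeHom_append (isPrefixFree_length N) f hw u

theorem act_levHom_of_le {N : ℕ} (f : List (Fin m) → AutT m) {w : List (Fin m)}
    (hw : w.length ≤ N) : act (levHom m N f) w = w := by
  have := act_placeHom_congr (n := N) (f := f) (f' := 1) (W := {w | w.length = N})
    (fun _ _ => Iff.rfl) (fun w h1 h2 => absurd h1 h2.ne) w hw
  rwa [map_one, act_one] at this

theorem sectionAt_levHom {N : ℕ} (f : List (Fin m) → AutT m) {w : List (Fin m)}
    (hw : w.length = N) : sectionAt (levHom m N f) w = f w := by
  apply act_ext
  intro u
  rw [act_sectionAt_eq_iff, act_levHom_append f hw, act_levHom_of_le f hw.le]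

theorem eq_levHom_of_mem {N : ℕ} {g : AutT m} (hg : g ∈ levelStab m N) :
    g = levHom m N (sectionAt g) := by
  apply act_ext
  intro u
  rcases le_total u.length N with h | h
  · rw [act_levHom_of_le _ h, act_of_mem_levelStab hg h]
  · rw [← List.take_append_drop N u]
    have hl : (u.take N).length = N := by simpa using h
    rw [act_levHom_append _ hl, act_append_section, hg _ hl]

theorem levHom_congr {N : ℕ} {f f' : List (Fin m) → AutT m}
    (h : ∀ w : List (Fin m), w.length = N → f w = f' w) : levHom m N f = levHom m N f' := by
  apply act_ext
  intro u
  exact act_placeHom_congr (n := N + 1 + u.length) (fun _ _ => Iff.rfl)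
    (fun w hw _ _ _ => by rw [h w hw]) u (by omega)

theorem levHom_mem_levelStab {N : ℕ} (f : List (Fin m) → AutT m) :
    levHom m N f ∈ levelStab m N := fun _ hv => act_levHom_of_le f hv.le

theorem IsBranching.levHom_mem {K : Subgroup (AutT m)} (hK : IsBranching K) (N : ℕ)
    {f : List (Fin m) → AutT m} (hf : ∀ w, f w ∈ K) : levHom m N f ∈ K :=
  hK.placeHom_mem (n := N) (fun _ hw => hw.le) (fun w _ => hf w)

theorem conj_levHom {N : ℕ} (h : AutT m) (f : List (Fin m) → AutT m) :
    h * levHom m N f * h⁻¹ = levHom m N (fun w => sectionAt h (act h⁻¹ w) * f (act h⁻¹ w) *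
      (sectionAt h (act h⁻¹ w))⁻¹) := by
  have hm : h * levHom m N f * h⁻¹ ∈ levelStab m N :=
    (levelStab_normal m N).conj_mem _ (levHom_mem_levelStab f) h
  rw [eq_levHom_of_mem hm]
  refine levHom_congr fun w hw => ?_
  have hw' : (act h⁻¹ w).length = N := by rw [length_act, hw]
  rw [sectionAt_mul, sectionAt_mul, sectionAt_inv, act_levHom_of_le f hw'.le,
    sectionAt_levHom f hw']

/-! ### Counting congruence classes -/

/-- The action of `Aut T_m` on the words of length `n`. -/
def levelHom (m n : ℕ) : AutT m →* Equiv.Perm {v : List (Fin m) // v.length = n} where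
  toFun g :=
    { toFun := fun v => ⟨act g v, by rw [length_act, v.2]⟩
      invFun := fun v => ⟨act g⁻¹ v, by rw [length_act, v.2]⟩
      left_inv := fun v => Subtype.ext (act_inv_act g v)
      right_inv := fun v => Subtype.ext (act_act_inv g v) }
  map_one' := rfl
  map_mul' _ _ := rfl

instance finite_words (n : ℕ) : Finite {v : List (Fin m) // v.length = n} :=
  (List.finite_length_eq (Fin m) n).to_subtype

theorem ker_levelHom (n : ℕ) : (levelHom m n).ker = levelStab m n := by
  ext g
  rw [MonoidHom.mem_ker, Equiv.ext_iff]
  exact ⟨fun h v hv => congrArg Subtype.val (h ⟨v, hv⟩), fun h v => Subtype.ext (h v.1 v.2)⟩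

instance levelStab_finiteIndex (n : ℕ) : (levelStab m n).FiniteIndex := by
  rw [← ker_levelHom]
  infer_instance

/-- The number of classes modulo `St(n)` of elements of `A`. -/
noncomputable def levelCard (n : ℕ) (A : Subgroup (AutT m)) : ℕ := (levelStab m n).relIndex A

theorem relIndex_levelStab_ne_zero (n : ℕ) (A : Subgroup (AutT m)) :
    (levelStab m n).relIndex A ≠ 0 :=
  have := Subgroup.isFiniteRelIndex_of_finiteIndex (H := levelStab m n) (K := A)
  Subgroup.relIndex_ne_zero

theorem levelCard_pos (n : ℕ) (A : Subgroup (AutT m)) : 0 < levelCard n A :=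
  Nat.pos_of_ne_zero (relIndex_levelStab_ne_zero n A)

theorem levelCard_mono (n : ℕ) {A B : Subgroup (AutT m)} (h : A ≤ B) :
    levelCard n A ≤ levelCard n B :=
  Subgroup.relIndex_le_of_le_right h (relIndex_levelStab_ne_zero n B)

theorem levelCard_le_of_le_sup {n : ℕ} {A B : Subgroup (AutT m)} (h : A ≤ B ⊔ levelStab m n) :
    levelCard n A ≤ levelCard n B :=
  (levelCard_mono n h).trans_eq (Subgroup.relIndex_sup_right _ _)

theorem topologicalClosure_le_sup (n : ℕ) (A : Subgroup (AutT m)) :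
    A.topologicalClosure ≤ A ⊔ levelStab m n := by
  intro g hg
  obtain ⟨a, ha, h⟩ := (mem_topologicalClosure_iff A g).1 hg n
  exact (mem_sup_levelStab_iff A n g).2 ⟨a, ha, fun v hv => (h v hv).symm⟩

theorem levelCard_topologicalClosure (n : ℕ) (A : Subgroup (AutT m)) :
    levelCard n A.topologicalClosure = levelCard n A :=
  (levelCard_le_of_le_sup (topologicalClosure_le_sup n A)).antisymm
    (levelCard_mono n A.le_topologicalClosure)

/-- H Γₙ / Γₙ is H / (H ∩ St(n)), so the numerator depends on `H` alone. -/
theorem hdim_eq_liminf {Γ H : Subgroup (AutT m)} (hH : H ≤ Γ) :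
    hdim Γ H = liminf (fun n : ℕ =>
      Real.log (levelCard n H) / Real.log (levelCard n Γ)) atTop := by
  refine congrArg (fun u => liminf u atTop) (funext fun n => ?_)
  have h1 : (levelStab m n ⊓ Γ).relIndex Γ = levelCard n Γ := Subgroup.inf_relIndex_right _ _
  have h2 : (levelStab m n ⊓ Γ).relIndex (H ⊔ (levelStab m n ⊓ Γ)) = levelCard n H := by
    set X := H ⊔ (levelStab m n ⊓ Γ) with hX
    have hXΓ : X ≤ Γ := sup_le hH inf_le_right
    have h3 : (levelStab m n ⊓ Γ) ⊓ X = levelStab m n ⊓ X := by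
      rw [inf_assoc, inf_eq_right.2 hXΓ]
    rw [← Subgroup.inf_relIndex_right, h3, Subgroup.inf_relIndex_right]
    exact (levelCard_le_of_le_sup (sup_le_sup_left inf_le_left H)).antisymm
      (levelCard_mono n le_sup_left)
  rw [h1, h2]

theorem levelCard_eq_card_map (n : ℕ) (A : Subgroup (AutT m)) :
    levelCard n A = Nat.card (A.map (QuotientGroup.mk' (levelStab m n))) := by
  rw [← Subgroup.relIndex_ker, QuotientGroup.ker_mk', levelCard]

theorem placeHom_mem_levelStab_iff {V : Set (List (Fin m))} (hV : IsPrefixFree V) (n : ℕ)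
    (f : List (Fin m) → AutT m) : placeHom V f ∈ levelStab m n ↔
      ∀ v ∈ V, v.length < n → f v ∈ levelStab m (n - v.length) := by
  constructor
  · intro h v hv hvn u hu
    have := h (v ++ u) (by rw [List.length_append]; omega)
    rwa [act_placeHom_append hV f hv, List.append_cancel_left_eq] at this
  · intro h u hu
    have := act_placeHom_congr (n := n) (W := V) (W' := V) (f := f) (f' := 1)
      (fun _ _ => Iff.rfl) (fun v hv hvn w hw => act_of_mem_levelStab (h v hv hvn) (by omega))
      u hu.le
    rwa [map_one, act_one] at this

theorem finite_length_lt (V : Set (List (Fin m))) (n : ℕ) :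
    {v ∈ V | v.length < n}.Finite :=
  (List.finite_length_lt (Fin m) n).subset fun _ hv => hv.2

/-- The elements with sections in `A v` at the words `v` of `V`. -/
noncomputable def placeSub (V : Set (List (Fin m))) (A : List (Fin m) → Subgroup (AutT m)) :
    Subgroup (AutT m) := (Subgroup.pi Set.univ A).map (placeHom V)

/-- Modulo St(n) only the finitely many coordinates with |v| < n survive, each modulo St(n - |v|).
Reducing these coordinates and reducing `placeHom V` have the same kernel, so the images of the
product of the `A v` have equal order. -/
theorem levelCard_placeSub {V : Set (List (Fin m))} (hV : IsPrefixFree V) (n : ℕ)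
    (A : List (Fin m) → Subgroup (AutT m)) : levelCard n (placeSub V A) =
      ∏ v ∈ (finite_length_lt V n).toFinset, levelCard (n - v.length) (A v) := by
  classical
  set F := (finite_length_lt V n).toFinset with hF
  let Ψ : (List (Fin m) → AutT m) →* (∀ v : F, AutT m ⧸ levelStab m (n - v.1.length)) :=
    MonoidHom.pi fun v => (QuotientGroup.mk' _).comp (Pi.evalMonoidHom _ v.1)
  have hker : Ψ.ker = ((QuotientGroup.mk' (levelStab m n)).comp (placeHom V)).ker := by
    ext f
    rw [← MonoidHom.comap_ker, Subgroup.mem_comap, QuotientGroup.ker_mk',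
      placeHom_mem_levelStab_iff hV, MonoidHom.mem_ker, funext_iff]
    simp only [Subtype.forall, hF, Set.Finite.mem_toFinset, Set.mem_ofPred_eq]
    constructor
    · intro h v hv hvn
      exact (QuotientGroup.eq_one_iff _).1 (h v ⟨hv, hvn⟩)
    · rintro h v ⟨hv, hvn⟩
      exact (QuotientGroup.eq_one_iff _).2 (h v hv hvn)
  have hmap : (Subgroup.pi Set.univ A).map Ψ = Subgroup.pi Set.univ
      (fun v : F => (A v.1).map (QuotientGroup.mk' (levelStab m (n - v.1.length)))) := by
    ext y
    rw [Subgroup.mem_map, Subgroup.mem_pi]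
    constructor
    · rintro ⟨f, hf, rfl⟩ v -
      exact ⟨f v.1, hf v.1 trivial, rfl⟩
    · intro h
      choose g hg hgy using fun v => h v trivial
      refine ⟨fun w => if hw : w ∈ F then g ⟨w, hw⟩ else 1, fun w _ => ?_, ?_⟩
      · dsimp only
        split_ifs with hw
        · exact hg ⟨w, hw⟩
        · exact (A w).one_mem
      · funext v
        rw [← hgy v]
        change QuotientGroup.mk' (levelStab m (n - v.1.length))
          (if hw : v.1 ∈ F then g ⟨v.1, hw⟩ else 1) = _
        rw [dif_pos v.2]
  rw [levelCard_eq_card_map, placeSub, Subgroup.map_map, ← Subgroup.relIndex_ker, ← hker,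
    Subgroup.relIndex_ker, hmap]
  have e : ↥(Subgroup.pi Set.univ
      (fun v : F => (A v.1).map (QuotientGroup.mk' (levelStab m (n - v.1.length))))) ≃
      (∀ v : F, ↥((A v.1).map (QuotientGroup.mk' (levelStab m (n - v.1.length))))) :=
    { toFun := fun y v => ⟨y.1 v, y.2 v trivial⟩
      invFun := fun y => ⟨fun v => (y v).1, fun v _ => (y v).2⟩
      left_inv := fun _ => rfl
      right_inv := fun _ => rfl }
  rw [Nat.card_congr e, Nat.card_pi, ← Finset.prod_coe_sort F]
  exact Finset.prod_congr rfl fun v _ => (levelCard_eq_card_map _ _).symm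

theorem ncard_words (N : ℕ) : (List.finite_length_eq (Fin m) N).toFinset.card = m ^ N := by
  rw [← Nat.card_eq_card_finite_toFinset]
  have : Nat.card (List.Vector (Fin m) N) = m ^ N := by simp
  exact this

theorem levelCard_levSub (N n : ℕ) (A : Subgroup (AutT m)) :
    levelCard (N + n) (placeSub {w : List (Fin m) | w.length = N} fun _ => A) =
      levelCard n A ^ m ^ N := by
  rw [levelCard_placeSub (isPrefixFree_length N)]
  -- For `n = 0` no word of length `N` is shorter than `N + n`, so the product is empty.
  rcases Nat.eq_zero_or_pos n with rfl | hn
  · have h0 : levelCard 0 A = 1 := by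
      rw [levelCard, levelStab_zero, Subgroup.relIndex_top_left]
    rw [h0, one_pow]
    refine Finset.prod_eq_one fun v hv => ?_
    simp only [Set.Finite.mem_toFinset, Set.mem_ofPred_eq] at hv
    omega
  · rw [← ncard_words N]
    have : (finite_length_lt {w : List (Fin m) | w.length = N} (N + n)).toFinset =
        (List.finite_length_eq (Fin m) N).toFinset := by
      ext w
      simp only [Set.Finite.mem_toFinset, Set.mem_ofPred_eq]
      omega
    rw [this]
    refine Finset.prod_eq_pow_card fun v hv => ?_
    simp only [Set.Finite.mem_toFinset, Set.mem_ofPred_eq] at hv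
    rw [hv, Nat.add_sub_cancel_left]

theorem IsBranching.levelCard_pow_le {K : Subgroup (AutT m)} (hK : IsBranching K) (N n : ℕ) :
    levelCard n K ^ m ^ N ≤ levelCard (N + n) K := by
  rw [← levelCard_levSub]
  refine levelCard_mono _ ?_
  rintro _ ⟨f, hf, rfl⟩
  exact hK.levHom_mem N fun w => hf w trivial

theorem levelCard_succ_le (n : ℕ) : levelCard (1 + n) (⊤ : Subgroup (AutT m)) ≤
    levelCard 1 (⊤ : Subgroup (AutT m)) * levelCard n (⊤ : Subgroup (AutT m)) ^ m := by
  have h1 : (levelStab m (1 + n)).relIndex (levelStab m 1) ≤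
      levelCard n (⊤ : Subgroup (AutT m)) ^ m := by
    have := levelCard_levSub 1 n (⊤ : Subgroup (AutT m))
    rw [pow_one] at this
    rw [← this]
    refine levelCard_mono _ fun g hg => ?_
    exact ⟨sectionAt g, fun _ _ => trivial, (eq_levHom_of_mem hg).symm⟩
  rw [levelCard, ← Subgroup.relIndex_mul_relIndex _ _ _
    (levelStab_anti (Nat.le_add_right 1 n)) le_top, mul_comm]
  exact Nat.mul_le_mul_left _ h1

theorem card_quotient_eq (n : ℕ) :
    Nat.card (AutT m ⧸ levelStab m n) = levelCard n (⊤ : Subgroup (AutT m)) := by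
  rw [levelCard, Subgroup.relIndex_top_right, Subgroup.index_eq_card]

/-- An `E`-th power fixes the first level, `E` being the order of Aut T_m / St(1). Applied to the
sections on level `n`, a further `E`-th power gains one level. -/
theorem pow_mem_levelStab (g : AutT m) (n : ℕ) :
    g ^ levelCard 1 (⊤ : Subgroup (AutT m)) ^ n ∈ levelStab m n := by
  set E := levelCard 1 (⊤ : Subgroup (AutT m)) with hE
  have hone : ∀ g : AutT m, g ^ E ∈ levelStab m 1 := by
    intro g
    rw [← QuotientGroup.eq_one_iff, QuotientGroup.mk_pow, hE, ← card_quotient_eq]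
    exact pow_card_eq_one'
  induction n with
  | zero => rw [levelStab_zero]; trivial
  | succ n ih =>
    rw [pow_succ, pow_mul]
    set h := g ^ E ^ n
    rw [eq_levHom_of_mem ih, ← map_pow]
    intro v hv
    have hv' : (v.take n).length = n := by simp [hv]
    rw [← List.take_append_drop n v, act_levHom_append _ hv', Pi.pow_apply,
      hone _ _ (by rw [List.length_drop, hv]; omega)]

/-- The abelianization of the image `B` of `A` is generated by at most `S.card` elements and has
exponent dividing `E ^ n`. -/
theorem levelCard_le_commutator {A : Subgroup (AutT m)} {S : Finset (AutT m)}
    (hS : Subgroup.closure (S : Set (AutT m)) = A) (n : ℕ) :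
    levelCard n A ≤ levelCard n ⁅A, A⁆ *
      levelCard 1 (⊤ : Subgroup (AutT m)) ^ (n * S.card) := by
  classical
  set E := levelCard 1 (⊤ : Subgroup (AutT m)) with hE
  set π := QuotientGroup.mk' (levelStab m n)
  set B := A.map π with hB
  have hcard : Nat.card (commutator B) = levelCard n ⁅A, A⁆ := by
    rw [levelCard_eq_card_map, Subgroup.map_commutator]
    have : (commutator B).map B.subtype = ⁅B, B⁆ := by
      rw [commutator_def, Subgroup.map_commutator, ← MonoidHom.range_eq_map,
        Subgroup.range_subtype]
    change _ = Nat.card ↥⁅B, B⁆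
    rw [← this]
    exact Nat.card_congr ((commutator B).equivMapOfInjective _ B.subtype_injective).toEquiv
  have hgen : Subgroup.closure ((S.image π : Finset _) : Set (AutT m ⧸ levelStab m n)) = B := by
    rw [Finset.coe_image, ← MonoidHom.map_closure, hS]
  have hrank : Group.rank (Abelianization B) ≤ S.card := by
    calc Group.rank (Abelianization B) ≤ Group.rank B :=
          Group.rank_le_of_surjective Abelianization.of (QuotientGroup.mk'_surjective _)
      _ = Group.rank (Subgroup.closure ((S.image π : Finset _) : Set (AutT m ⧸ levelStab m n))) :=
          Subgroup.rank_congr hgen.symm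
      _ ≤ (S.image π).card := Subgroup.rank_closure_finset_le_card _
      _ ≤ S.card := Finset.card_image_le
  have hexp : ∀ x : Abelianization B, x ^ E ^ n = 1 := by
    intro x
    obtain ⟨y, rfl⟩ := QuotientGroup.mk'_surjective _ x
    obtain ⟨g, -, hy⟩ := y.2
    have : y ^ E ^ n = 1 := by
      apply Subtype.ext
      rw [Subgroup.coe_pow, ← hy, ← map_pow]
      exact (QuotientGroup.eq_one_iff _).2 (pow_mem_levelStab g n)
    change Abelianization.of y ^ E ^ n = 1
    rw [← map_pow, this, map_one]
  have hEpos : 0 < E := levelCard_pos _ _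
  have hab : Nat.card (Abelianization B) ≤ E ^ (n * S.card) := by
    rw [pow_mul]
    exact (Nat.le_of_dvd (by positivity) (card_dvd_exponent_pow_rank' _ hexp)).trans
      (Nat.pow_le_pow_right (by positivity) hrank)
  calc levelCard n A = Nat.card B := levelCard_eq_card_map n A
    _ = Nat.card (commutator B) * (commutator B).index := (Subgroup.card_mul_index _).symm
    _ = levelCard n ⁅A, A⁆ * Nat.card (Abelianization B) := by rw [hcard]; rfl
    _ ≤ _ := Nat.mul_le_mul_left _ hab

/-! ### Growth of the number of congruence classes -/

/-- The logarithm of the number of classes modulo `St(n)` of elements of `A`. -/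
noncomputable def logCard (n : ℕ) (A : Subgroup (AutT m)) : ℝ := Real.log (levelCard n A)

theorem logCard_nonneg (n : ℕ) (A : Subgroup (AutT m)) : 0 ≤ logCard n A :=
  Real.log_natCast_nonneg _

theorem levelCard_cast_pos (n : ℕ) (A : Subgroup (AutT m)) : (0 : ℝ) < levelCard n A :=
  Nat.cast_pos.2 (levelCard_pos n A)

theorem logCard_le_of_le_sup {n : ℕ} {A B : Subgroup (AutT m)} (h : A ≤ B ⊔ levelStab m n) :
    logCard n A ≤ logCard n B :=
  Real.log_le_log (levelCard_cast_pos n A) (Nat.cast_le.2 (levelCard_le_of_le_sup h))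

theorem logCard_mono (n : ℕ) {A B : Subgroup (AutT m)} (h : A ≤ B) :
    logCard n A ≤ logCard n B := logCard_le_of_le_sup (h.trans le_sup_left)

theorem logCard_topologicalClosure (n : ℕ) (A : Subgroup (AutT m)) :
    logCard n A.topologicalClosure = logCard n A := by
  rw [logCard, levelCard_topologicalClosure, logCard]

theorem logCard_levSub (N n : ℕ) (A : Subgroup (AutT m)) :
    logCard (N + n) (placeSub {w : List (Fin m) | w.length = N} fun _ => A) =
      m ^ N * logCard n A := by
  rw [logCard, levelCard_levSub, Nat.cast_pow, Real.log_pow, logCard]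
  push_cast
  rfl

theorem logCard_placeSub {V : Set (List (Fin m))} (hV : IsPrefixFree V) (n : ℕ)
    (A : List (Fin m) → Subgroup (AutT m)) : logCard n (placeSub V A) =
      ∑ v ∈ (finite_length_lt V n).toFinset, logCard (n - v.length) (A v) := by
  rw [logCard, levelCard_placeSub hV, Nat.cast_prod,
    Real.log_prod fun v _ => (levelCard_cast_pos _ _).ne']
  rfl

theorem IsBranching.mul_logCard_le {K : Subgroup (AutT m)} (hK : IsBranching K) (n : ℕ) :
    m * logCard n K ≤ logCard (n + 1) K := by
  have := Real.log_le_log (by exact_mod_cast pow_pos (levelCard_pos n K) _)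
    (Nat.cast_le (α := ℝ).2 (hK.levelCard_pow_le 1 n))
  rwa [pow_one, Nat.cast_pow, Real.log_pow, add_comm] at this

theorem logCard_zero (A : Subgroup (AutT m)) : logCard 0 A = 0 := by
  rw [logCard, levelCard, levelStab_zero, Subgroup.relIndex_top_left, Nat.cast_one, Real.log_one]

/-- The `- 1` makes the induction close: `1 + m * (m ^ n - 1) ≤ m ^ (n + 1) - 1` because `m ≥ 2`. -/
theorem logCard_top_le (hm : 2 ≤ m) (n : ℕ) : logCard n (⊤ : Subgroup (AutT m)) ≤
    logCard 1 (⊤ : Subgroup (AutT m)) * (m ^ n - 1) := by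
  induction n with
  | zero => simp [logCard_zero]
  | succ n ih =>
    have h1 := Real.log_le_log (levelCard_cast_pos _ _)
      (Nat.cast_le (α := ℝ).2 (levelCard_succ_le (m := m) n))
    rw [Nat.cast_mul, Real.log_mul (levelCard_cast_pos _ _).ne'
      (by exact_mod_cast (pow_pos (levelCard_pos n _) _).ne'), Nat.cast_pow, Real.log_pow,
      add_comm 1 n] at h1
    change logCard (n + 1) _ ≤ logCard 1 _ + m * logCard n _ at h1
    have hm' : (2 : ℝ) ≤ m := by exact_mod_cast hm
    have h2 := mul_le_mul_of_nonneg_left ih (by linarith : (0 : ℝ) ≤ m)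
    have h3 := logCard_nonneg 1 (⊤ : Subgroup (AutT m))
    rw [pow_succ]
    nlinarith

theorem logCard_le_commutator {A : Subgroup (AutT m)} {S : Finset (AutT m)}
    (hS : Subgroup.closure (S : Set (AutT m)) = A) (n : ℕ) :
    logCard n A ≤ logCard n ⁅A, A⁆ + n * (S.card * logCard 1 (⊤ : Subgroup (AutT m))) := by
  have h := Real.log_le_log (levelCard_cast_pos _ _)
    (Nat.cast_le (α := ℝ).2 (levelCard_le_commutator hS n))
  rw [Nat.cast_mul, Real.log_mul (levelCard_cast_pos _ _).ne'
    (by exact_mod_cast (pow_pos (levelCard_pos 1 _) _).ne'), Nat.cast_pow, Real.log_pow,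
    Nat.cast_mul, mul_assoc] at h
  exact h

theorem eq_bot_of_forall_levelCard_eq_one {A : Subgroup (AutT m)}
    (h : ∀ n, levelCard n A = 1) : A = ⊥ := by
  rw [eq_bot_iff]
  intro g hg
  exact act_ext fun v => Subgroup.relIndex_eq_one.1 (h v.length) hg v rfl

theorem IsBranching.exists_growth (hm : 2 ≤ m) {K : Subgroup (AutT m)} (hK : IsBranching K)
    (hne : K ≠ ⊥) : ∃ c : ℝ, 0 < c ∧ (∀ n, logCard n K ≤ c * m ^ n) ∧
      Tendsto (fun n => logCard n K / m ^ n) atTop (𝓝 c) := by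
  have hm0 : (0 : ℝ) < m := by exact_mod_cast (by omega : 0 < m)
  set u : ℕ → ℝ := fun n => logCard n K / m ^ n with hu
  have hmono : Monotone u := monotone_nat_of_le_succ fun n => by
    rw [hu]
    dsimp only
    rw [div_le_div_iff₀ (by positivity) (by positivity), pow_succ]
    have := mul_le_mul_of_nonneg_right (hK.mul_logCard_le n) (by positivity : (0 : ℝ) ≤ m ^ n)
    linarith
  have hbdd : BddAbove (Set.range u) := by
    refine ⟨logCard 1 (⊤ : Subgroup (AutT m)), ?_⟩
    rintro _ ⟨n, rfl⟩
    rw [hu]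
    dsimp only
    rw [div_le_iff₀ (by positivity)]
    have h1 := (logCard_mono n (le_top : K ≤ ⊤)).trans (logCard_top_le hm n)
    have h3 := logCard_nonneg 1 (⊤ : Subgroup (AutT m))
    linarith
  refine ⟨⨆ n, u n, ?_, fun n => ?_, tendsto_atTop_ciSup hmono hbdd⟩
  · obtain ⟨n, hn⟩ : ∃ n, levelCard n K ≠ 1 := by
      by_contra! h
      exact hne (eq_bot_of_forall_levelCard_eq_one h)
    have h2 : (1 : ℝ) < levelCard n K := by
      have := levelCard_pos n K
      exact_mod_cast (by omega : 1 < levelCard n K)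
    exact (div_pos (Real.log_pos h2) (by positivity)).trans_le (le_ciSup hbdd n)
  · rw [← div_le_iff₀ (by positivity)]
    exact le_ciSup hbdd n

theorem tendsto_linear_div_pow (hm : 2 ≤ m) (C : ℝ) :
    Tendsto (fun n : ℕ => n * C / (m : ℝ) ^ n) atTop (𝓝 0) := by
  have h := (tendsto_pow_const_div_const_pow_of_one_lt 1
    (by exact_mod_cast (by omega : 1 < m) : (1 : ℝ) < m)).mul_const C
  rw [zero_mul] at h
  refine h.congr fun n => ?_
  rw [pow_one]
  ring

theorem logCard_commutator_bounds (hm : 2 ≤ m) {A : Subgroup (AutT m)} {S : Finset (AutT m)}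
    (hS : Subgroup.closure (S : Set (AutT m)) = A) (n : ℕ) :
    logCard n ⁅A, A⁆ / m ^ n ≤ logCard n A / m ^ n ∧
      logCard n A / m ^ n ≤ logCard n ⁅A, A⁆ / m ^ n +
        n * (S.card * logCard 1 (⊤ : Subgroup (AutT m))) / m ^ n := by
  have hm0 : (0 : ℝ) < m := by exact_mod_cast (by omega : 0 < m)
  rw [← add_div]
  exact ⟨div_le_div_of_nonneg_right (logCard_mono n (Subgroup.commutator_le_self A))
    (by positivity), div_le_div_of_nonneg_right (logCard_le_commutator hS n) (by positivity)⟩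

theorem tendsto_logCard_commutator (hm : 2 ≤ m) {A : Subgroup (AutT m)} (hA : A.FG) {c : ℝ} :
    Tendsto (fun n => logCard n ⁅A, A⁆ / (m : ℝ) ^ n) atTop (𝓝 c) ↔
      Tendsto (fun n => logCard n A / (m : ℝ) ^ n) atTop (𝓝 c) := by
  obtain ⟨S, hS⟩ := hA
  have hb := logCard_commutator_bounds hm hS
  have h0 := tendsto_linear_div_pow hm (S.card * logCard 1 (⊤ : Subgroup (AutT m)))
  constructor
  · intro h
    refine tendsto_of_tendsto_of_tendsto_of_le_of_le h ?_ (fun n => (hb n).1) fun n => (hb n).2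
    simpa using h.add h0
  · intro h
    refine tendsto_of_tendsto_of_tendsto_of_le_of_le ?_ h
      (fun n => sub_le_iff_le_add.2 (hb n).2) fun n => (hb n).1
    simpa using h.sub h0

/-! ### Hausdorff dimension as a ratio of growth constants. -/

theorem logCard_div_mem_Icc {Γ H : Subgroup (AutT m)} (hH : H ≤ Γ) (n : ℕ) :
    logCard n H / logCard n Γ ∈ Set.Icc (0 : ℝ) 1 :=
  ⟨div_nonneg (logCard_nonneg _ _) (logCard_nonneg _ _),
    div_le_one_of_le₀ (logCard_mono n hH) (logCard_nonneg _ _)⟩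

theorem isBoundedUnder_logCard_div {Γ H : Subgroup (AutT m)} (hH : H ≤ Γ) :
    IsBoundedUnder (· ≤ ·) atTop (fun n => logCard n H / logCard n Γ) ∧
      IsBoundedUnder (· ≥ ·) atTop (fun n => logCard n H / logCard n Γ) :=
  ⟨isBoundedUnder_of ⟨1, fun n => (logCard_div_mem_Icc hH n).2⟩,
    isBoundedUnder_of ⟨0, fun n => (logCard_div_mem_Icc hH n).1⟩⟩

theorem hdim_mem_Icc {Γ H : Subgroup (AutT m)} (hH : H ≤ Γ) : hdim Γ H ∈ Set.Icc (0 : ℝ) 1 := by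
  rw [hdim_eq_liminf hH]
  obtain ⟨h1, h2⟩ := isBoundedUnder_logCard_div hH
  exact ⟨le_liminf_of_le h1.isCoboundedUnder_ge
      (Eventually.of_forall fun n => (logCard_div_mem_Icc hH n).1),
    liminf_le_of_le h2 fun b hb => by
      obtain ⟨n, hn⟩ := hb.exists
      exact hn.trans (logCard_div_mem_Icc hH n).2⟩

/-- The ratios never exceed 1, so a lower limit 1 is a limit. -/
theorem tendsto_of_hdim_eq_one {Γ H : Subgroup (AutT m)} (hH : H ≤ Γ) (h : hdim Γ H = 1) :
    Tendsto (fun n => logCard n H / logCard n Γ) atTop (𝓝 1) := by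
  rw [hdim_eq_liminf hH] at h
  obtain ⟨h1, h2⟩ := isBoundedUnder_logCard_div hH
  refine tendsto_of_le_liminf_of_limsup_le h.ge ?_ h1 h2
  exact limsup_le_of_le h2.isCoboundedUnder_le
    (Eventually.of_forall fun n => (logCard_div_mem_Icc hH n).2)

theorem hdim_eq_of_tendsto (hm : 2 ≤ m) {Γ H : Subgroup (AutT m)} (hH : H ≤ Γ) {c d : ℝ}
    (hc : 0 < c) (h1 : Tendsto (fun n => logCard n Γ / (m : ℝ) ^ n) atTop (𝓝 c))
    (h2 : Tendsto (fun n => logCard n H / (m : ℝ) ^ n) atTop (𝓝 (d * c))) : hdim Γ H = d := by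
  have hm0 : (0 : ℝ) < m := by exact_mod_cast (by omega : 0 < m)
  rw [hdim_eq_liminf hH]
  apply Tendsto.liminf_eq
  have h := h2.div h1 hc.ne'
  rw [mul_div_cancel_right₀ _ hc.ne'] at h
  refine h.congr fun n => ?_
  exact div_div_div_cancel_right₀ (by positivity) _ _

theorem tendsto_logCard_of_hdim_eq_one (hm : 2 ≤ m) {Γ H : Subgroup (AutT m)} (hH : H ≤ Γ)
    (h : hdim Γ H = 1) {c : ℝ} (hc : 0 < c)
    (h1 : Tendsto (fun n => logCard n H / (m : ℝ) ^ n) atTop (𝓝 c)) :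
    Tendsto (fun n => logCard n Γ / (m : ℝ) ^ n) atTop (𝓝 c) := by
  have h2 := h1.div (tendsto_of_hdim_eq_one hH h) one_ne_zero
  rw [div_one] at h2
  refine h2.congr' ?_
  filter_upwards [h1.eventually_ne hc.ne'] with n hn
  have hn0 : logCard n H ≠ 0 := fun h0 => hn (by rw [h0, zero_div])
  simp only [Pi.div_apply]
  field_simp

/-- Passing to all `m ^ N` vertices `N` levels below a vertex of level `a` does not change the share
of the growth: the limit does not involve `N`. -/
theorem tendsto_logCard_shift (hm : 2 ≤ m) {Y : Subgroup (AutT m)} {c : ℝ}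
    (h : Tendsto (fun n => logCard n Y / (m : ℝ) ^ n) atTop (𝓝 c)) (a N : ℕ) :
    Tendsto (fun n => m ^ N * logCard (n - a - N) Y / (m : ℝ) ^ n) atTop
      (𝓝 (((m : ℝ) ^ a)⁻¹ * c)) := by
  have hm0 : (0 : ℝ) < m := by exact_mod_cast (by omega : 0 < m)
  have h1 : Tendsto (fun n : ℕ => n - (a + N)) atTop atTop := tendsto_sub_atTop_nat _
  refine ((h.comp h1).const_mul (((m : ℝ) ^ a)⁻¹)).congr' ?_
  filter_upwards [eventually_ge_atTop (a + N)] with n hn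
  obtain ⟨k, rfl⟩ := Nat.exists_eq_add_of_le hn
  have e1 : a + N + k - (a + N) = k := by omega
  have e2 : a + N + k - a - N = k := by omega
  simp only [Function.comp, e1, e2]
  rw [pow_add, pow_add]
  field_simp

/-- The growth of a subgroup that lies between the product of copies of `Y` at the words `v ++ u`
with `v` in `V` and `u` of length `N v` and the product of copies of `K` at the words of `V`, where
`K` and `Y` have the same growth. -/
theorem tendsto_logCard_of_placeSub (hm : 2 ≤ m) {V : Set (List (Fin m))} (hV : IsPrefixFree V)
    {d : ℝ} (hd : HasSum (fun v : V => ((m : ℝ) ^ v.1.length)⁻¹) d) (N : List (Fin m) → ℕ)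
    {K Y H : Subgroup (AutT m)} {c : ℝ} (hc : 0 < c) (hK : ∀ n, logCard n K ≤ c * m ^ n)
    (hY : Tendsto (fun n => logCard n Y / (m : ℝ) ^ n) atTop (𝓝 c))
    (h1 : ∀ n, H ≤ placeSub V (fun _ => K) ⊔ levelStab m n)
    (h2 : ∀ n, placeSub V (fun v => placeSub {w : List (Fin m) | w.length = N v} fun _ => Y) ≤
      H ⊔ levelStab m n) :
    Tendsto (fun n => logCard n H / (m : ℝ) ^ n) atTop (𝓝 (d * c)) := by
  classical
  have hm0 : (0 : ℝ) < m := by exact_mod_cast (by omega : 0 < m)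
  -- The bound `hK` holds at every level, so no uniformity in `v` is needed.
  have hupper : ∀ n, logCard n H / (m : ℝ) ^ n ≤ d * c := by
    intro n
    rw [div_le_iff₀ (by positivity)]
    refine (logCard_le_of_le_sup (h1 n)).trans ?_
    rw [logCard_placeSub hV]
    calc ∑ v ∈ (finite_length_lt V n).toFinset, logCard (n - v.length) K
        ≤ ∑ v ∈ (finite_length_lt V n).toFinset, ((m : ℝ) ^ v.length)⁻¹ * (c * m ^ n) := by
          refine Finset.sum_le_sum fun v hv => (hK _).trans_eq ?_
          simp only [Set.Finite.mem_toFinset, Set.mem_ofPred_eq] at hv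
          rw [pow_sub₀ _ hm0.ne' hv.2.le]
          ring
      _ = (∑ v ∈ (finite_length_lt V n).toFinset, ((m : ℝ) ^ v.length)⁻¹) * (c * m ^ n) :=
          (Finset.sum_mul _ _ _).symm
      _ ≤ d * (c * m ^ n) := by
          refine mul_le_mul_of_nonneg_right ?_ (by positivity)
          have := sum_le_hasSum ((finite_length_lt V n).toFinset.subtype (· ∈ V))
            (fun v _ => by positivity) hd
          rwa [Finset.sum_subtype_of_mem (fun v : List (Fin m) => ((m : ℝ) ^ v.length)⁻¹)
            fun v hv => ((Set.Finite.mem_toFinset _).1 hv).1] at this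
      _ = d * c * m ^ n := by ring
  refine tendsto_order.2 ⟨fun a ha => ?_, fun a ha =>
    Eventually.of_forall fun n => (hupper n).trans_lt ha⟩
  have hdc : Tendsto (fun F : Finset V => ∑ v ∈ F, ((m : ℝ) ^ v.1.length)⁻¹ * c) atTop
      (𝓝 (d * c)) := hd.mul_right c
  -- `N` may be unbounded on `V`, so the lower bound uses only a finite part of `V` that already
  -- carries more than `a`.
  obtain ⟨F, hF⟩ := (hdc.eventually (lt_mem_nhds ha)).exists
  have hlim := tendsto_finsetSum F fun v _ =>
    tendsto_logCard_shift hm hY v.1.length (N v.1)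
  -- The `+ 1` places `v` strictly above level `n`, so that it occurs in the sum for `placeSub V`.
  have hlarge : ∀ᶠ n in atTop, ∀ v ∈ F, v.1.length + N v.1 + 1 ≤ n :=
    (Filter.eventually_all_finset F).2 fun v _ => eventually_ge_atTop _
  filter_upwards [hlim.eventually (lt_mem_nhds hF), hlarge] with n hn hn'
  refine hn.trans_le ?_
  rw [← Finset.sum_div]
  refine div_le_div_of_nonneg_right ?_ (by positivity)
  refine le_trans ?_ (logCard_le_of_le_sup (h2 n))
  rw [logCard_placeSub hV]
  calc ∑ v ∈ F, (m : ℝ) ^ N v.1 * logCard (n - v.1.length - N v.1) Y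
      = ∑ v ∈ F.map (Function.Embedding.subtype (· ∈ V)),
          logCard (n - v.length) (placeSub {w : List (Fin m) | w.length = N v} fun _ => Y) := by
        rw [Finset.sum_map]
        refine Finset.sum_congr rfl fun v hv => ?_
        have hv' := hn' v hv
        rw [← logCard_levSub]
        congr 1
        simp only [Function.Embedding.subtype_apply]
        omega
    _ ≤ _ := by
        refine Finset.sum_le_sum_of_subset_of_nonneg ?_ fun v _ _ => logCard_nonneg _ _
        intro v hv
        rw [Finset.mem_map] at hv
        obtain ⟨v, hv, rfl⟩ := hv
        have hv' := hn' v hv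
        rw [Set.Finite.mem_toFinset]
        refine ⟨v.2, ?_⟩
        simp only [Function.Embedding.subtype_apply]
        omega

/-! ### Prefix-free sets of given weight -/

theorem exists_isPrefixFree_hasSum (hm : 2 ≤ m) {d : ℝ} (hd : d ∈ Set.Icc (0 : ℝ) 1) :
    ∃ V : Set (List (Fin m)), IsPrefixFree V ∧
      HasSum (fun v : V => ((m : ℝ) ^ v.1.length)⁻¹) d := by
  obtain ⟨δ, -, hδ⟩ := Real.ofDigits_SurjOn (by omega : 1 < m) hd
  let z : Fin m := ⟨0, by omega⟩
  -- The letters 1, …, δ i: each digit gives δ i words zⁱy of length i + 1. As `y` is never the zero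
  -- letter, a word determines `i` as the position of its first nonzero letter, hence
  -- prefix-freeness.
  let y : (Σ i, Fin (δ i)) → Fin m := fun j => ⟨j.2 + 1, by omega⟩
  have hyz : ∀ j, y j ≠ z := fun j h => by simpa [y, z] using congrArg Fin.val h
  let φ : (Σ i, Fin (δ i)) → List (Fin m) := fun j => List.replicate j.1 z ++ [y j]
  have hlen : ∀ j, (φ j).length = j.1 + 1 := fun j => by simp [φ]
  have hφ : Function.Injective φ := by
    intro j j' h
    have h1 : j.1 = j'.1 := by
      have := congrArg List.length h
      rw [hlen, hlen] at this
      omega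
    obtain ⟨i, a⟩ := j
    obtain ⟨i', a'⟩ := j'
    obtain rfl : i = i' := h1
    have h2 := (List.append_inj h rfl).2
    simp only [List.cons.injEq, and_true, y, Fin.mk.injEq] at h2
    rw [Fin.ext (by omega : a.val = a'.val)]
  refine ⟨Set.range φ, ?_, ?_⟩
  · rintro _ ⟨j, rfl⟩ _ ⟨j', rfl⟩ h
    have hle := h.length_le
    rw [hlen, hlen] at hle
    rcases (by omega : j.1 = j'.1 ∨ j.1 < j'.1) with h1 | h1
    · exact h.eq_of_length (by rw [hlen, hlen, h1])
    · exfalso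
      have := h.getElem (i := j.1) (by rw [hlen]; omega)
      simp only [φ] at this
      rw [List.getElem_append_right (by simp), List.getElem_append_left (by simpa using h1)] at this
      exact hyz j (by simpa using this)
  · rw [← (Equiv.ofInjective φ hφ).hasSum_iff]
    have hterm : HasSum (Real.ofDigitsTerm δ) d := by
      rw [← hδ]
      exact Real.summable_ofDigitsTerm.hasSum
    have hin : ∀ i, HasSum (fun _ : Fin (δ i) => ((m : ℝ) ^ (i + 1))⁻¹)
        (Real.ofDigitsTerm δ i) := by
      intro i
      have := hasSum_fintype (fun _ : Fin (δ i) => ((m : ℝ) ^ (i + 1))⁻¹)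
      simpa [Real.ofDigitsTerm] using this
    have hs : Summable (fun j : (Σ i, Fin (δ i)) => ((m : ℝ) ^ (j.1 + 1))⁻¹) := by
      rw [summable_sigma_of_nonneg fun _ => by positivity]
      refine ⟨fun i => (hin i).summable, ?_⟩
      simp_rw [fun i => (hin i).tsum_eq]
      exact hterm.summable
    have := HasSum.sigma_of_hasSum hterm hin hs
    convert this using 2 with j
    simp only [Function.comp, Equiv.ofInjective_apply, hlen]

/-! ### Separating elements -/

/-- Unwanted coincidences are removed level by level; a correction on level `l * (J + 1)` leaves the
earlier ones untouched. -/
theorem exists_act_ne {K : Subgroup (AutT m)} (hK : IsBranching K) {l : ℕ}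
    {p q : List (Fin m)} (hq : q.length = l) (hpq : p ≠ q) {c : AutT m} (hcK : c ∈ K)
    (hc : act c q = p) (J : ℕ) : ∃ h ∈ K, act h q = p ∧ ∀ k, 1 ≤ k → k ≤ J →
      ∀ z : List (Fin m), z.length = l * k → act h (z ++ q) ≠ act h z ++ p := by
  classical
  induction J with
  | zero => exact ⟨c, hcK, hc, fun k h1 h2 => by omega⟩
  | succ J ih =>
    obtain ⟨h, hhK, hhq, hh⟩ := ih
    -- Where the section of `h` takes `q` to `p`, inserting `c` first makes it take `q` to the image
    -- of `p`, which differs from `p` by injectivity.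
    set f : List (Fin m) → AutT m := fun y => if act (sectionAt h y) q = p then c else 1 with hf
    have hfK : ∀ y, f y ∈ K := fun y => by
      rw [hf]
      dsimp only
      split_ifs
      exacts [hcK, K.one_mem]
    refine ⟨h * levHom m (l * (J + 1)) f, K.mul_mem hhK (hK.levHom_mem _ hfK), ?_, ?_⟩
    · rw [act_mul, act_levHom_of_le f (by rw [hq]; exact Nat.le_mul_of_pos_right l J.succ_pos), hhq]
    · intro k h1 h2 z hz
      rcases (by omega : k ≤ J ∨ k = J + 1) with hk | rfl
      · have hle : l * (k + 1) ≤ l * (J + 1) := Nat.mul_le_mul_left _ (by omega)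
        rw [mul_add, mul_one] at hle
        rw [act_mul, act_mul, act_levHom_of_le f (by rw [List.length_append, hz, hq]; exact hle),
          act_levHom_of_le f (by omega)]
        exact hh k h1 hk z hz
      · rw [act_mul, act_mul, act_levHom_append f hz, act_levHom_of_le f hz.le,
          act_append_section, Ne, List.append_cancel_left_eq, hf]
        dsimp only
        split_ifs with h3
        · rw [hc]
          intro h4
          exact hpq (act_injective _ (h4.trans h3.symm))
        · rwa [act_one]

/-- The element of `exists_act_ne` is put at `y₀` alone. Elsewhere the action is trivial and `p ≠ q`
excludes a coincidence. -/
theorem exists_act_eq_only_at {K : Subgroup (AutT m)} (hK : IsBranching K) {l : ℕ}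
    {p q : List (Fin m)} (hq : q.length = l) (hpq : p ≠ q) {c : AutT m} (hcK : c ∈ K)
    (hc : act c q = p) {k₀ : ℕ} {y₀ : List (Fin m)} (hy₀ : y₀.length = l * k₀) (J : ℕ) :
    ∃ h ∈ K, act h (y₀ ++ q) = y₀ ++ p ∧ ∀ k ≤ J, ∀ y : List (Fin m), y.length = l * k →
      act h (y ++ q) = act h y ++ p → k = k₀ ∧ y = y₀ := by
  classical
  obtain ⟨h, hhK, hhq, hh⟩ := exists_act_ne hK hq hpq hcK hc J
  set f : List (Fin m) → AutT m := Pi.mulSingle y₀ h with hf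
  have hf0 : f y₀ = h := Pi.mulSingle_eq_same _ _
  have hf1 : ∀ y, y ≠ y₀ → f y = 1 := fun y hy => Pi.mulSingle_eq_of_ne hy _
  refine ⟨levHom m (l * k₀) f, hK.levHom_mem _ fun w => ?_, ?_, ?_⟩
  · by_cases hw : w = y₀
    · rwa [hw, hf0]
    · rw [hf1 w hw]; exact K.one_mem
  · rw [act_levHom_append f hy₀, hf0, hhq]
  · intro k hkJ y hy hyq
    rcases lt_or_ge k k₀ with hk | hk
    · exfalso
      have hle : l * (k + 1) ≤ l * k₀ := Nat.mul_le_mul_left _ hk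
      rw [mul_add, mul_one] at hle
      rw [act_levHom_of_le f (by rw [List.length_append, hy, hq]; exact hle),
        act_levHom_of_le f (by omega), List.append_cancel_left_eq] at hyq
      exact hpq hyq.symm
    · obtain ⟨i, rfl⟩ := Nat.exists_eq_add_of_le hk
      obtain ⟨a, z, rfl, ha, hz⟩ : ∃ a z, y = a ++ z ∧ a.length = l * k₀ ∧ z.length = l * i := by
        rw [mul_add] at hy
        refine ⟨y.take (l * k₀), y.drop (l * k₀), (List.take_append_drop _ _).symm, ?_, ?_⟩
        · rw [List.length_take, hy]; omega
        · rw [List.length_drop, hy]; omega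
      rw [List.append_assoc, act_levHom_append f ha, act_levHom_append f ha, List.append_assoc,
        List.append_cancel_left_eq] at hyq
      by_cases hay : a = y₀
      · rw [hay, hf0] at hyq
        rcases Nat.eq_zero_or_pos i with rfl | hi
        · rw [mul_zero, List.length_eq_zero_iff] at hz
          exact ⟨rfl, by rw [hz, hay, List.append_nil]⟩
        · exact absurd hyq (hh i hi (by omega) z hz)
      · rw [hf1 a hay, act_one, act_one, List.append_cancel_left_eq] at hyq
        exact absurd hyq.symm hpq

/-! ### Commutators supported at a single vertex. -/

/-- The family with value `s` at the words that end in `p`. -/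
def tailFun (p : List (Fin m)) (s : AutT m) (w : List (Fin m)) : AutT m :=
  if p <:+ w then s else 1

theorem tailFun_mem {K : Subgroup (AutT m)} {s : AutT m} (hs : s ∈ K) (p w : List (Fin m)) :
    tailFun p s w ∈ K := by
  rw [tailFun]
  split_ifs
  exacts [hs, K.one_mem]

/-- The commutator is computed coordinatewise on one level and can be nontrivial only where both
supports meet: at `w` ending in `p` with `h⁻¹ w` ending in `q`. By `h1` the only such `w` is `y₀ ++
p`. -/
theorem commutator_tail {l : ℕ} {p q : List (Fin m)} (hp : p.length = l) (hq : q.length = l)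
    {k₀ : ℕ} {y₀ : List (Fin m)} (hy₀ : y₀.length = l * k₀) {J : ℕ} {h : AutT m}
    (h0 : act h (y₀ ++ q) = y₀ ++ p)
    (h1 : ∀ k ≤ J, ∀ y : List (Fin m), y.length = l * k →
      act h (y ++ q) = act h y ++ p → k = k₀ ∧ y = y₀) (s s' : AutT m) {k : ℕ} (hk : k ≤ J) :
    ⁅levHom m (l * k + l) (tailFun p s), h * levHom m (l * k + l) (tailFun q s') * h⁻¹⁆ =
      if k = k₀ then levHom m (l * k₀ + l) (Pi.mulSingle (y₀ ++ p)
        ⁅s, sectionAt h (y₀ ++ q) * s' * (sectionAt h (y₀ ++ q))⁻¹⁆) else 1 := by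
  classical
  rw [conj_levHom, ← map_commutatorElement]
  have hp0 : act h⁻¹ (y₀ ++ p) = y₀ ++ q := by rw [act_inv_eq_iff, h0]
  have key : ∀ w : List (Fin m), w.length = l * k + l → ¬ (k = k₀ ∧ w = y₀ ++ p) →
      ⁅tailFun p s w, sectionAt h (act h⁻¹ w) * tailFun q s' (act h⁻¹ w) *
        (sectionAt h (act h⁻¹ w))⁻¹⁆ = 1 := by
    intro w hw hne
    by_cases hpw : p <:+ w
    · by_cases hqw : q <:+ act h⁻¹ w
      · exfalso
        obtain ⟨y, hy⟩ := hqw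
        have hyl : y.length = l * k := by
          have := congrArg List.length hy
          rw [length_act, List.length_append] at this
          omega
        have hw' : w = act h (y ++ q) := by rw [hy, act_act_inv]
        obtain ⟨y', rfl⟩ := hpw
        obtain ⟨r, hr, hr'⟩ := act_append h y q
        have hrp : p = r := (List.append_inj' (hw'.trans hr') (by omega)).2
        obtain ⟨rfl, rfl⟩ := h1 k hk y hyl (by rw [hr', hrp])
        exact hne ⟨rfl, by rw [hw', h0]⟩
      · rw [tailFun, tailFun, if_neg hqw, mul_one, mul_inv_cancel, commutatorElement_one_right]
    · rw [tailFun, if_neg hpw, commutatorElement_one_left]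
  split_ifs with hkk
  · subst hkk
    refine levHom_congr fun w hw => ?_
    by_cases hw0 : w = y₀ ++ p
    · subst hw0
      change ⁅tailFun p s _, sectionAt h (act h⁻¹ (y₀ ++ p)) * tailFun q s' (act h⁻¹ (y₀ ++ p)) *
        (sectionAt h (act h⁻¹ (y₀ ++ p)))⁻¹⁆ = _
      rw [hp0, Pi.mulSingle_eq_same, tailFun, tailFun, if_pos (List.suffix_append _ _),
        if_pos (List.suffix_append _ _)]
    · rw [Pi.mulSingle_eq_of_ne hw0]
      exact key w hw fun h => hw0 h.2
  · rw [← map_one (levHom m (l * k + l))]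
    exact levHom_congr fun w hw => key w hw fun h => hkk h.1

/-- Commutators of a generating set with a conjugate of it. -/
theorem commutator_le_of_conj {A : Type*} [Group A] {K B : Subgroup A} {S : Set A}
    (hS : Subgroup.closure S = K) (hB : ∀ k ∈ K, ∀ b ∈ B, k * b * k⁻¹ ∈ B) {γ : A}
    (h1 : ∀ k ∈ K, γ * k * γ⁻¹ ∈ K) (h2 : ∀ k ∈ K, γ⁻¹ * k * γ ∈ K)
    (h : ∀ s ∈ S, ∀ s' ∈ S, ⁅s, γ * s' * γ⁻¹⁆ ∈ B) : ⁅K, K⁆ ≤ B := by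
  have hSK : S ⊆ K := hS ▸ Subgroup.subset_closure
  have hB' : ∀ k ∈ K, ∀ b ∈ B, k⁻¹ * b * k ∈ B := fun k hk b hb => by
    simpa using hB k⁻¹ (K.inv_mem hk) b hb
  -- Induction in the second argument; `B` is stable under conjugation by `K`, which contains the
  -- conjugates by `γ`.
  have step1 : ∀ s ∈ S, ∀ x ∈ K, ⁅s, γ * x * γ⁻¹⁆ ∈ B := by
    intro s hs x hx
    rw [← hS] at hx
    induction hx using Subgroup.closure_induction with
    | mem x hx => exact h s hs x hx
    | one => simp
    | mul x y hx hy ihx ihy =>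
      rw [hS] at hx hy
      have e : ⁅s, γ * (x * y) * γ⁻¹⁆ = ⁅s, γ * x * γ⁻¹⁆ *
          ((γ * x * γ⁻¹) * ⁅s, γ * y * γ⁻¹⁆ * (γ * x * γ⁻¹)⁻¹) := by
        simp only [commutatorElement_def]; group
      rw [e]
      exact B.mul_mem ihx (hB _ (h1 x hx) _ ihy)
    | inv x hx ihx =>
      rw [hS] at hx
      have e : ⁅s, γ * x⁻¹ * γ⁻¹⁆ =
          (γ * x * γ⁻¹)⁻¹ * ⁅s, γ * x * γ⁻¹⁆⁻¹ * (γ * x * γ⁻¹) := by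
        simp only [commutatorElement_def]; group
      rw [e]
      exact hB' _ (h1 x hx) _ (B.inv_mem ihx)
  -- Since `γ` normalizes `K`, every `x` in `K` has the form `γ * k * γ⁻¹` with `k` in `K`; now
  -- induction in the first argument.
  have step2 : ∀ x ∈ K, ∀ s ∈ K, ⁅s, x⁆ ∈ B := by
    intro x hx s hs
    rw [← hS] at hs
    induction hs using Subgroup.closure_induction with
    | mem s hs =>
      have := step1 s hs _ (h2 x hx)
      have e : γ * (γ⁻¹ * x * γ) * γ⁻¹ = x := by group
      rwa [e] at this
    | one => simp
    | mul a b ha hb iha ihb =>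
      rw [hS] at ha
      have e : ⁅a * b, x⁆ = a * ⁅b, x⁆ * a⁻¹ * ⁅a, x⁆ := by
        simp only [commutatorElement_def]; group
      rw [e]
      exact B.mul_mem (hB _ ha _ ihb) iha
    | inv a ha iha =>
      rw [hS] at ha
      have e : ⁅a⁻¹, x⁆ = a⁻¹ * ⁅a, x⁆⁻¹ * a := by
        simp only [commutatorElement_def]; group
      rw [e]
      exact hB' _ ha _ (B.inv_mem iha)
  exact Subgroup.commutator_le.2 fun s hs x hx => step2 x hx s hs

/-- The element whose section at each word `v` of `V` has, on the level `N v` below `v`, the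
section `s` at the words ending in `p` and trivial sections elsewhere. -/
noncomputable def spread (V : Set (List (Fin m))) (N : List (Fin m) → ℕ) (p : List (Fin m))
    (s : AutT m) : AutT m := placeHom V fun v => levHom m (N v) (tailFun p s)

/-- The embedding of `Aut T_m` at the vertex `v ++ u`, where `v` is a word of `V`. -/
noncomputable def singleHom (V : Set (List (Fin m))) (v u : List (Fin m)) (N : ℕ) :
    AutT m →* AutT m :=
  (placeHom V).comp ((MonoidHom.mulSingle (fun _ => AutT m) v).comp
    ((levHom m N).comp (MonoidHom.mulSingle (fun _ => AutT m) u)))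

theorem singleHom_apply (V : Set (List (Fin m)))
    (v u : List (Fin m)) (N : ℕ) (x : AutT m) : singleHom V v u N x =
      placeHom V (Pi.mulSingle v (levHom m N (Pi.mulSingle u x))) := rfl

/-- At each `v` with |v| < n the commutator is that of `commutator_tail` with `k = ν v`; injectivity
of `ν` leaves `v₀` alone. -/
theorem commutator_spread_mem {V : Set (List (Fin m))} {ν : List (Fin m) → ℕ}
    (hν : Function.Injective ν) {l : ℕ} {p q : List (Fin m)} (hp : p.length = l)
    (hq : q.length = l) {v₀ y₀ : List (Fin m)} (hy₀ : y₀.length = l * ν v₀) {n J : ℕ}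
    (hJ : ∀ v ∈ V, v.length < n → ν v ≤ J) {h : AutT m} (h0 : act h (y₀ ++ q) = y₀ ++ p)
    (h1 : ∀ k ≤ J, ∀ y : List (Fin m), y.length = l * k →
      act h (y ++ q) = act h y ++ p → k = ν v₀ ∧ y = y₀)
    {H : Subgroup (AutT m)} {s s' : AutT m} (hs : spread V (fun v => l * ν v + l) p s ∈ H)
    (hs' : spread V (fun v => l * ν v + l) q s' ∈ H) (hh : placeHom V (fun _ => h) ∈ H) :
    singleHom V v₀ (y₀ ++ p) (l * ν v₀ + l)
      ⁅s, sectionAt h (y₀ ++ q) * s' * (sectionAt h (y₀ ++ q))⁻¹⁆ ∈ H ⊔ levelStab m n := by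
  classical
  rw [mem_sup_levelStab_iff]
  refine ⟨⁅spread V (fun v => l * ν v + l) p s,
    placeHom V (fun _ => h) * spread V (fun v => l * ν v + l) q s' *
      (placeHom V (fun _ => h))⁻¹⁆, ?_, fun u hu => ?_⟩
  · rw [commutatorElement_def]
    have := H.mul_mem (H.mul_mem hh hs') (H.inv_mem hh)
    exact H.mul_mem (H.mul_mem (H.mul_mem hs this) (H.inv_mem hs)) (H.inv_mem this)
  · rw [spread, spread, ← map_inv, ← map_mul, ← map_mul, ← map_commutatorElement, singleHom_apply]
    refine act_placeHom_congr (n := n) (fun _ _ => Iff.rfl) (fun v hv hvn w _ => ?_) u hu.le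
    have hc := commutator_tail hp hq hy₀ h0 h1 s s' (hJ v hv hvn)
    refine congrArg (fun g => act g w) (hc.trans ?_)
    split_ifs with hvv
    · obtain rfl := hν hvv
      rw [Pi.mulSingle_eq_same]
    · rw [Pi.mulSingle_eq_of_ne fun h => hvv (congrArg ν h)]

/-- On some level every word is moved by some element of the normal subgroup `K`. -/
theorem exists_level_moved {G K : Subgroup (AutT m)} (hG : IsLevelTransitive G)
    (hn : ∀ g ∈ G, ∀ k ∈ K, g * k * g⁻¹ ∈ K) (hK : K ≠ ⊥) :
    ∃ l : ℕ, ∀ p : List (Fin m), p.length = l → ∃ c ∈ K, act c p ≠ p := by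
  obtain ⟨c, hcK, hc⟩ := (Subgroup.bot_or_exists_ne_one K).resolve_left hK
  obtain ⟨v, hv⟩ : ∃ v, act c v ≠ v := by
    by_contra! h
    exact hc (act_ext h)
  refine ⟨v.length, fun p hp => ?_⟩
  obtain ⟨g, hg, rfl⟩ := hG v p hp.symm
  refine ⟨g * c * g⁻¹, hn g hg _ hcK, fun h => hv ?_⟩
  rw [act_mul, act_mul, act_inv_act] at h
  exact act_injective g h

/-- The elements `x` placed in `H ⊔ levelStab m n` form a subgroup that contains all `⁅s, γ * s' *
γ⁻¹⁆`. It is stable under conjugation by `K`, thanks to diagonal elements of `H` with `k` at `y₀ ++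
p` below every `v`. By `commutator_le_of_conj` it contains `⁅K, K⁆`. -/
theorem singleHom_mem {G K H : Subgroup (AutT m)} (hGs : IsSelfSimilar G) (hKG : K ≤ G)
    (hKb : IsBranching K) (hn : ∀ g ∈ G, ∀ k ∈ K, g * k * g⁻¹ ∈ K) {S : Set (AutT m)}
    (hS : Subgroup.closure S = K) {V : Set (List (Fin m))}
    {ν : List (Fin m) → ℕ} (hν : Function.Injective ν) {l : ℕ} {p q : List (Fin m)}
    (hp : p.length = l) (hq : q.length = l) (hpq : p ≠ q) {c : AutT m} (hcK : c ∈ K)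
    (hc : act c q = p) (hD : ∀ k ∈ K, placeHom V (fun _ => k) ∈ H)
    (hT : ∀ s ∈ S, spread V (fun v => l * ν v + l) p s ∈ H)
    (hT' : ∀ s ∈ S, spread V (fun v => l * ν v + l) q s ∈ H) (n : ℕ)
    {v₀ y₀ : List (Fin m)} (hy₀ : y₀.length = l * ν v₀) {x : AutT m}
    (hx : x ∈ ⁅K, K⁆) :
    singleHom V v₀ (y₀ ++ p) (l * ν v₀ + l) x ∈ H ⊔ levelStab m n := by
  classical
  -- Only finitely many `v` matter modulo St(n), so `h` need only be controlled up to a finite `J`;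
  -- it depends on `n`, the generators of `H` do not.
  obtain ⟨J, hJ⟩ : ∃ J, ∀ v ∈ V, v.length < n → ν v ≤ J := by
    obtain ⟨J, hJ⟩ := ((finite_length_lt V n).image ν).bddAbove
    exact ⟨J, fun v hv hvn => hJ ⟨v, ⟨hv, hvn⟩, rfl⟩⟩
  obtain ⟨h, hhK, h0, h1⟩ := exists_act_eq_only_at hKb hq hpq hcK hc hy₀ J
  set γ := sectionAt h (y₀ ++ q)
  have hγ : γ ∈ G := hGs h (hKG hhK) _
  have hle : ⁅K, K⁆ ≤ (H ⊔ levelStab m n).comap (singleHom V v₀ (y₀ ++ p) (l * ν v₀ + l)) := by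
    refine commutator_le_of_conj (γ := γ) hS ?_ (hn γ hγ) ?_ ?_
    · intro k hk b hb
      rw [Subgroup.mem_comap] at hb ⊢
      have hk' : levHom m (l * ν v₀ + l) (Pi.mulSingle (y₀ ++ p) k) ∈ K := by
        refine hKb.levHom_mem _ fun w => ?_
        by_cases hw : w = y₀ ++ p
        · rwa [hw, Pi.mulSingle_eq_same]
        · rw [Pi.mulSingle_eq_of_ne hw]; exact K.one_mem
      set D := placeHom V (fun _ => levHom m (l * ν v₀ + l) (Pi.mulSingle (y₀ ++ p) k))
      have hDH : D ∈ H ⊔ levelStab m n := Subgroup.mem_sup_left (hD _ hk')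
      have e : singleHom V v₀ (y₀ ++ p) (l * ν v₀ + l) (k * b * k⁻¹) =
          D * singleHom V v₀ (y₀ ++ p) (l * ν v₀ + l) b * D⁻¹ := by
        simp only [singleHom_apply, D]
        rw [← map_inv, ← map_mul, ← map_mul]
        congr 1
        funext w
        by_cases hw : w = v₀
        · subst hw
          simp only [Pi.mul_apply, Pi.inv_apply, Pi.mulSingle_eq_same]
          rw [← map_inv, ← map_mul, ← map_mul, Pi.mulSingle_mul, Pi.mulSingle_mul,
            Pi.mulSingle_inv]
        · simp only [Pi.mul_apply, Pi.inv_apply, Pi.mulSingle_eq_of_ne hw]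
          group
      rw [e]
      exact Subgroup.mul_mem _ (Subgroup.mul_mem _ hDH hb) (Subgroup.inv_mem _ hDH)
    · intro k hk
      simpa using hn γ⁻¹ (G.inv_mem hγ) k hk
    · intro s hs s' hs'
      exact commutator_spread_mem hν hp hq hy₀ hJ h0 h1 (hT s hs) (hT' s' hs') (hD h hhK)
  exact hle hx

/-- Modulo St(n) an element of the product is a finite product of elements with a single nontrivial
coordinate. -/
theorem placeSub_le_sup {V : Set (List (Fin m))} {N : List (Fin m) → ℕ}
    {H Y : Subgroup (AutT m)} {n : ℕ}
    (h : ∀ v u : List (Fin m), u.length = N v → ∀ x ∈ Y,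
      singleHom V v u (N v) x ∈ H ⊔ levelStab m n) :
    placeSub V (fun v => placeSub {w : List (Fin m) | w.length = N v} fun _ => Y) ≤
      H ⊔ levelStab m n := by
  classical
  rintro _ ⟨f, hf, rfl⟩
  have h1 : ∀ v, placeHom V (Pi.mulSingle v (f v)) ∈ H ⊔ levelStab m n := by
    intro v
    obtain ⟨g, hg, hgf⟩ := hf v trivial
    set F := (List.finite_length_eq (Fin m) (N v)).toFinset
    set g' : List (Fin m) → AutT m := fun u => if u ∈ F then g u else 1 with hg'
    have hgg' : f v = levHom m (N v) g' := by
      rw [← hgf]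
      refine levHom_congr fun w hw => ?_
      rw [hg']
      dsimp only
      rw [if_pos ((Set.Finite.mem_toFinset (List.finite_length_eq (Fin m) (N v))).2 hw)]
    have : g' ∈ (H ⊔ levelStab m n).comap ((placeHom V).comp
        ((MonoidHom.mulSingle (fun _ => AutT m) v).comp (levHom m (N v)))) := by
      refine Submonoid.pi_mem_of_mulSingle_mem_aux F g' (fun u hu => if_neg hu) fun u hu => ?_
      have := h v u ((Set.Finite.mem_toFinset (List.finite_length_eq (Fin m) (N v))).1 hu) (g' u) (by
        rw [hg']
        dsimp only
        rw [if_pos hu]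
        exact hg u trivial)
      rw [singleHom_apply] at this
      exact this
    rw [hgg']
    exact this
  set F := (List.finite_length_lt (Fin m) n).toFinset
  set f' : List (Fin m) → AutT m := fun v => if v ∈ F then f v else 1 with hf'
  have h2 : f' ∈ (H ⊔ levelStab m n).comap (placeHom V) := by
    refine Submonoid.pi_mem_of_mulSingle_mem_aux F f' (fun u hu => if_neg hu) fun u hu => ?_
    have : f' u = f u := if_pos hu
    rw [this]
    exact h1 u
  obtain ⟨a, ha, hab⟩ := (mem_sup_levelStab_iff _ _ _).1 h2
  refine (mem_sup_levelStab_iff _ _ _).2 ⟨a, ha, fun u hu => (hab u hu).trans ?_⟩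
  refine act_placeHom_congr (n := n) (fun _ _ => Iff.rfl) (fun v _ hvn w _ => ?_) u hu.le
  rw [hf']
  dsimp only
  rw [if_pos ((Set.Finite.mem_toFinset (List.finite_length_lt (Fin m) n)).2 hvn)]

/-- A branching group generated by boundedly many elements has, for every set `V` of words, a
subgroup with boundedly many generators that lies between products of copies of `⁅K, K⁆` and `K`
below the words of `V`. -/
theorem exists_subgroup {G K : Subgroup (AutT m)} (hG : IsWeaklyRegularBranchOver G K)
    (hn : ∀ g ∈ G, ∀ k ∈ K, g * k * g⁻¹ ∈ K) (hfg : K.FG) :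
    ∃ b : ℕ, ∀ V : Set (List (Fin m)), ∃ (N : List (Fin m) → ℕ)
      (T : Finset (AutT m)), T.card ≤ b ∧
      Subgroup.closure (T : Set (AutT m)) ≤ placeSub V (fun _ => K) ∧ ∀ n,
      placeSub V (fun v => placeSub {w : List (Fin m) | w.length = N v} fun _ => ⁅K, K⁆) ≤
        Subgroup.closure (T : Set (AutT m)) ⊔ levelStab m n := by
  classical
  obtain ⟨S, hS⟩ := hfg
  obtain ⟨l, hl⟩ := exists_level_moved hG.levelTransitive hn hG.ne_bot
  choose! c hcK hcne using hl
  set P := (List.finite_length_eq (Fin m) l).toFinset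
  refine ⟨S.card + (P ×ˢ S).card + (P ×ˢ S).card, fun V => ?_⟩
  -- Distinct words receive distinct levels, which lets one `h` single out both `v` and a vertex
  -- below it.
  set ν : List (Fin m) → ℕ := Encodable.encode
  set N : List (Fin m) → ℕ := fun v => l * ν v + l with hN
  set T₀ := S.image fun s => placeHom V fun _ => s
  set T₁ := (P ×ˢ S).image fun x => spread V N x.1 x.2
  -- The partner of `p` is `q = (c p)⁻¹ p`, different from `p` because `c p` moves `p`.
  set T₂ := (P ×ˢ S).image fun x => spread V N (act (c x.1)⁻¹ x.1) x.2
  have hSK : ∀ s ∈ S, s ∈ K := fun s hs => hS ▸ Subgroup.subset_closure hs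
  set H := Subgroup.closure ((T₀ ∪ T₁ ∪ T₂ : Finset (AutT m)) : Set (AutT m)) with hH
  have hTH : ∀ t ∈ T₀ ∪ T₁ ∪ T₂, t ∈ H := fun t ht => Subgroup.subset_closure ht
  have hspread : ∀ p, ∀ s ∈ S, spread V N p s ∈ placeSub V (fun _ => K) := fun p s hs =>
    ⟨_, fun v _ => hG.branching.levHom_mem _ fun w => tailFun_mem (hSK s hs) p w, rfl⟩
  refine ⟨N, T₀ ∪ T₁ ∪ T₂, ?_, ?_, fun n => placeSub_le_sup fun v u hu x hx => ?_⟩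
  · exact (Finset.card_union_le _ _).trans (add_le_add ((Finset.card_union_le _ _).trans
      (add_le_add Finset.card_image_le Finset.card_image_le)) Finset.card_image_le)
  · rw [Subgroup.closure_le]
    intro t ht
    simp only [Finset.coe_union, Set.mem_union, Finset.mem_coe, T₀, T₁, T₂, Finset.mem_image,
      Finset.mem_product] at ht
    rcases ht with (⟨s, hs, rfl⟩ | ⟨x, hx, rfl⟩) | ⟨x, hx, rfl⟩
    · exact ⟨_, fun v _ => hSK s hs, rfl⟩
    · exact hspread _ _ hx.2
    · exact hspread _ _ hx.2
  · obtain ⟨y₀, p, rfl, hy₀, hp⟩ : ∃ y p, u = y ++ p ∧ y.length = l * ν v ∧ p.length = l := by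
      refine ⟨u.take (l * ν v), u.drop (l * ν v), (List.take_append_drop _ _).symm, ?_, ?_⟩
      · rw [List.length_take, hu, hN]; dsimp only; omega
      · rw [List.length_drop, hu, hN]; dsimp only; omega
    have hpP : p ∈ P := (Set.Finite.mem_toFinset _).2 hp
    refine singleHom_mem hG.selfSimilar hG.le hG.branching hn hS Encodable.encode_injective hp
      (q := act (c p)⁻¹ p) (by rw [length_act, hp]) ?_ (hcK p hp) (act_act_inv _ _) ?_ ?_ ?_ n
      hy₀ hx
    · intro h
      exact hcne p hp ((act_inv_eq_iff _).1 h.symm).symm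
    · intro k hk
      rw [← hS] at hk
      let D : AutT m →* AutT m := (placeHom V).comp (Pi.constMonoidHom (List (Fin m)) (AutT m))
      have : Subgroup.closure (S : Set (AutT m)) ≤ H.comap D := by
        rw [Subgroup.closure_le]
        intro s hs
        exact hTH _ (Finset.mem_union_left _ (Finset.mem_union_left _
          (Finset.mem_image_of_mem _ hs)))
      exact this hk
    · intro s hs
      exact hTH _ (Finset.mem_union_left _ (Finset.mem_union_right _
        (Finset.mem_image.2 ⟨(p, s), Finset.mem_product.2 ⟨hpP, hs⟩, rfl⟩)))
    · intro s hs
      exact hTH _ (Finset.mem_union_right _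
        (Finset.mem_image.2 ⟨(p, s), Finset.mem_product.2 ⟨hpP, hs⟩, rfl⟩))

theorem hasCompleteBoundedSpectrum_of_branch (hm : 2 ≤ m) {G K : Subgroup (AutT m)}
    (hG : IsWeaklyRegularBranchOver G K) (hfg : K.FG) (hn : (K.subgroupOf G).Normal)
    (hdim1 : hdim G.topologicalClosure K.topologicalClosure = 1) :
    HasCompleteBoundedSpectrum G.topologicalClosure := by
  have hn' : ∀ g ∈ G, ∀ k ∈ K, g * k * g⁻¹ ∈ K := fun g hg k hk =>
    hn.conj_mem ⟨k, hG.le hk⟩ hk ⟨g, hg⟩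
  obtain ⟨b, hb⟩ := exists_subgroup hG hn' hfg
  obtain ⟨c, hc, hcK, hcl⟩ := hG.branching.exists_growth hm hG.ne_bot
  have hKG : K.topologicalClosure ≤ G.topologicalClosure :=
    Subgroup.topologicalClosure_mono hG.le
  have hGl : Tendsto (fun n => logCard n G.topologicalClosure / (m : ℝ) ^ n) atTop (𝓝 c) :=
    tendsto_logCard_of_hdim_eq_one hm hKG hdim1 hc (by simpa only [logCard_topologicalClosure])
  -- The `+ 1` only secures that the bound is at least 1.
  refine ⟨b + 1, by omega, Set.Subset.antisymm ?_ ?_⟩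
  · rintro _ ⟨H, hH, -, -, rfl⟩
    exact hdim_mem_Icc hH
  · intro d hd
    obtain ⟨V, hV, hsum⟩ := exists_isPrefixFree_hasSum hm hd
    obtain ⟨N, T, hT, h1, h2⟩ := hb V
    have hle : (Subgroup.closure (T : Set (AutT m))).topologicalClosure ≤
        G.topologicalClosure := by
      refine Subgroup.topologicalClosure_minimal _ (h1.trans ?_)
        (Subgroup.isClosed_topologicalClosure G)
      rintro _ ⟨f, hf, rfl⟩
      -- For infinite `V` the element need not lie in `K`, only in its closure.
      exact hKG (hG.branching.placeHom_mem_closure V fun w _ => hf w trivial)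
    refine ⟨_, hle, Subgroup.isClosed_topologicalClosure _, ⟨T, by omega, rfl⟩,
      hdim_eq_of_tendsto hm hle hc hGl ?_⟩
    simp only [logCard_topologicalClosure]
    exact tendsto_logCard_of_placeSub hm hV hsum N hc hcK
      ((tendsto_logCard_commutator hm hfg).2 hcl) (fun n => h1.trans le_sup_left) h2

/-! ### The Basilica group -/

/-- The element of the first level stabilizer of the binary tree with sections `x` and `y`. -/
noncomputable def pair (x y : AutT 2) : AutT 2 := levHom 2 1 fun w => if w = [0] then x else y

theorem act_pair_zero (x y : AutT 2) (u : List (Fin 2)) :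
    act (pair x y) (0 :: u) = 0 :: act x u :=
  act_levHom_append (w := [0]) _ rfl u

theorem act_pair_one (x y : AutT 2) (u : List (Fin 2)) :
    act (pair x y) (1 :: u) = 1 :: act y u :=
  act_levHom_append (w := [1]) _ rfl u

theorem ext_binary {f g : AutT 2} (h0 : ∀ u, act f (0 :: u) = act g (0 :: u))
    (h1 : ∀ u, act f (1 :: u) = act g (1 :: u)) : f = g := by
  apply act_ext
  rintro (_ | ⟨x, u⟩)
  · rw [act_nil, act_nil]
  · fin_cases x
    exacts [h0 u, h1 u]

theorem pair_mul (x y x' y' : AutT 2) : pair x y * pair x' y' = pair (x * x') (y * y') := by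
  apply ext_binary <;> intro u <;> simp only [act_mul, act_pair_zero, act_pair_one]

theorem pair_one : pair 1 1 = 1 := by
  apply ext_binary <;> intro u <;> simp only [act_one, act_pair_zero, act_pair_one]

theorem pair_inv (x y : AutT 2) : (pair x y)⁻¹ = pair x⁻¹ y⁻¹ := by
  rw [inv_eq_iff_mul_eq_one, pair_mul, mul_inv_cancel, mul_inv_cancel, pair_one]

/-- The generator `a` of the Basilica group. -/
abbrev genA : AutT 2 := basilicaGen true

/-- The generator `b` of the Basilica group. -/
abbrev genB : AutT 2 := basilicaGen false

theorem act_genB_zero (u : List (Fin 2)) : act genB (0 :: u) = 1 :: u := rfl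

theorem act_genB_one (u : List (Fin 2)) : act genB (1 :: u) = 0 :: act genA u := rfl

theorem genA_eq : genA = pair 1 genB := by
  apply ext_binary <;> intro u
  · rw [act_pair_zero]
    rfl
  · rw [act_pair_one]
    rfl

theorem genB_mul_self : genB * genB = pair genA genA := by
  apply ext_binary <;> intro u <;>
    simp only [act_mul, act_genB_zero, act_genB_one, act_pair_zero, act_pair_one]

theorem pair_mul_genB (x y : AutT 2) :
    pair x y * genB = genB * pair y (genA⁻¹ * x * genA) := by
  apply ext_binary <;> intro u <;>
    simp only [act_mul, act_genB_zero, act_genB_one, act_pair_zero, act_pair_one, act_act_inv]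

theorem inv_genB_conj (x y : AutT 2) :
    genB⁻¹ * pair x y * genB = pair y (genA⁻¹ * x * genA) := by
  rw [mul_assoc, pair_mul_genB, inv_mul_cancel_left]

theorem genB_conj (x y : AutT 2) :
    genB * pair x y * genB⁻¹ = pair (genA * y * genA⁻¹) x := by
  rw [mul_inv_eq_iff_eq_mul, pair_mul_genB]
  congr 2
  group

/-- The commutator `a⁻¹ b⁻¹ a b` of the generators of the Basilica group. -/
noncomputable def genC : AutT 2 := genA⁻¹ * genB⁻¹ * genA * genB

theorem genC_eq : genC = pair genB genB⁻¹ := by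
  have h : genC = genA⁻¹ * (genB⁻¹ * pair 1 genB * genB) := by
    rw [← genA_eq, genC]
    group
  rw [h, inv_genB_conj, mul_one, inv_mul_cancel, genA_eq, pair_inv, pair_mul, inv_one, one_mul,
    mul_one]

theorem pair_conj (u v x y : AutT 2) :
    pair u v * pair x y * (pair u v)⁻¹ = pair (u * x * u⁻¹) (v * y * v⁻¹) := by
  rw [pair_inv, pair_mul, pair_mul]

theorem genC_inv : genC⁻¹ = pair genB⁻¹ genB := by rw [genC_eq, pair_inv, inv_inv]

theorem genA_mul_genC : genA * genC = genC * genA := by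
  rw [genC_eq, genA_eq, pair_mul, pair_mul]
  congr 1
  group

theorem genA_conj_genC : genA * genC * genA⁻¹ = genC := by
  rw [genA_mul_genC, mul_inv_cancel_right]

theorem inv_genA_conj_genC : genA⁻¹ * genC * genA = genC := by
  rw [mul_assoc, ← genA_mul_genC, inv_mul_cancel_left]

theorem inv_genA_conj_genB : genA⁻¹ * genB * genA = genB * genC⁻¹ := by
  rw [genC]
  group

theorem genA_conj_genB : genA * genB * genA⁻¹ = genB * genC := by
  have h : genB = genA * (genA⁻¹ * genB * genA) * genA⁻¹ := by group
  rw [inv_genA_conj_genB] at h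
  have h' : genA * (genB * genC⁻¹) * genA⁻¹ =
      (genA * genB * genA⁻¹) * (genA * genC * genA⁻¹)⁻¹ := by group
  rw [h', genA_conj_genC] at h
  nth_rewrite 2 [h]
  rw [inv_mul_cancel_right]

theorem genA_mem : genA ∈ basilica := Subgroup.subset_closure (Or.inl rfl)

theorem genB_mem : genB ∈ basilica := Subgroup.subset_closure (Or.inr rfl)

/-- A subgroup normalized by the Basilica group that contains `[a, b]` contains the commutator
subgroup. -/
theorem commutator_basilica_le {X : Subgroup (AutT 2)}
    (hX : ∀ g ∈ basilica, ∀ x ∈ X, g * x * g⁻¹ ∈ X) (hc : genC ∈ X) :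
    ⁅basilica, basilica⁆ ≤ X := by
  have hab : ⁅genA, genB⁆ ∈ X := by
    have := hX _ (basilica.mul_mem genB_mem genA_mem) _ hc
    have e : ⁅genA, genB⁆ = genB * genA * genC * (genB * genA)⁻¹ := by
      rw [genC, commutatorElement_def]
      group
    rwa [e]
  refine commutator_le_of_conj (γ := 1) rfl hX (fun k hk => by simpa using hk)
    (fun k hk => by simpa using hk) ?_
  rintro s (rfl | rfl) s' (rfl | rfl) <;>
    simp only [one_mul, inv_one, mul_one, commutatorElement_self, X.one_mem]
  · exact hab
  · rw [← commutatorElement_inv]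
    exact X.inv_mem hab

theorem conj_mem_commutator {A : Type*} [Group A] {G : Subgroup A} {g k : A} (hg : g ∈ G)
    (hk : k ∈ ⁅G, G⁆) : g * k * g⁻¹ ∈ ⁅G, G⁆ := by
  have h := Subgroup.commutator_mem_commutator hg (Subgroup.commutator_le_self G hk)
  have := Subgroup.mul_mem _ h hk
  rwa [commutatorElement_def, inv_mul_cancel_right] at this

theorem genC_mem : genC ∈ ⁅basilica, basilica⁆ := by
  have := Subgroup.commutator_mem_commutator (basilica.inv_mem genA_mem)
    (basilica.inv_mem genB_mem)
  rwa [commutatorElement_def, inv_inv, inv_inv] at this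

/-- As b² = (a, a) and a = (1, b), the commutator of b⁻² and a⁻¹ is (1, a⁻¹b⁻¹ab). -/
theorem pair_one_genC_mem : pair 1 genC ∈ ⁅basilica, basilica⁆ := by
  have := Subgroup.commutator_mem_commutator
    (basilica.inv_mem (basilica.mul_mem genB_mem genB_mem)) (basilica.inv_mem genA_mem)
  rw [commutatorElement_def, inv_inv, inv_inv, genB_mul_self] at this
  have e : (pair genA genA)⁻¹ * genA⁻¹ * pair genA genA * genA = pair 1 genC := by
    have h : (pair genA genA)⁻¹ * (pair 1 genB)⁻¹ * pair genA genA * pair 1 genB =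
        pair 1 genC := by
      rw [pair_inv, pair_inv, pair_mul, pair_mul, pair_mul, genC]
      congr 1
      group
    rwa [← genA_eq] at h
  rwa [e] at this

/-- The second coordinates of b² = (a, a) and a = (1, b) generate the whole group. -/
theorem exists_pair_mem {g : AutT 2} (hg : g ∈ basilica) : ∃ x, pair x g ∈ basilica := by
  induction hg using Subgroup.closure_induction with
  | mem g hg =>
    rcases hg with rfl | rfl
    · exact ⟨genA, genB_mul_self ▸ basilica.mul_mem genB_mem genB_mem⟩
    · exact ⟨1, genA_eq ▸ genA_mem⟩
  | one => exact ⟨1, by rw [pair_one]; exact basilica.one_mem⟩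
  | mul g h _ _ ihg ihh =>
    obtain ⟨x, hx⟩ := ihg
    obtain ⟨y, hy⟩ := ihh
    exact ⟨x * y, pair_mul x g y h ▸ basilica.mul_mem hx hy⟩
  | inv g _ ihg =>
    obtain ⟨x, hx⟩ := ihg
    exact ⟨x⁻¹, pair_inv x g ▸ basilica.inv_mem hx⟩

/-- The embedding of `Aut T_2` as the automorphisms acting below the vertex `1` only. -/
noncomputable def pairHom : AutT 2 →* AutT 2 where
  toFun x := pair 1 x
  map_one' := pair_one
  map_mul' x y := by rw [pair_mul, one_mul]

/-- The `z` with (1, z) in the commutator subgroup are normalized by the Basilica group, by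
`exists_pair_mem`, and include `genC`; hence they include the commutator subgroup. Conjugation by
`genB⁻¹` moves such elements to the vertex 0. -/
theorem pair_mem_commutator {x y : AutT 2} (hx : x ∈ ⁅basilica, basilica⁆)
    (hy : y ∈ ⁅basilica, basilica⁆) : pair x y ∈ ⁅basilica, basilica⁆ := by
  have hle : ⁅basilica, basilica⁆ ≤ (⁅basilica, basilica⁆ : Subgroup (AutT 2)).comap pairHom := by
    refine commutator_basilica_le (fun g hg z hz => ?_) pair_one_genC_mem
    obtain ⟨w, hw⟩ := exists_pair_mem hg
    have h := conj_mem_commutator hw hz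
    change pair w g * pair 1 z * (pair w g)⁻¹ ∈ _ at h
    rwa [pair_inv, pair_mul, pair_mul, mul_one, mul_inv_cancel] at h
  have h1 := conj_mem_commutator (basilica.inv_mem genB_mem) (hle hx)
  change genB⁻¹ * pair 1 x * genB⁻¹⁻¹ ∈ _ at h1
  rw [inv_inv, inv_genB_conj, mul_one, inv_mul_cancel] at h1
  have h2 := Subgroup.mul_mem _ h1 (hle hy)
  change pair x 1 * pair 1 y ∈ _ at h2
  rwa [pair_mul, one_mul, mul_one] at h2

theorem isBranching_commutator : IsBranching (⁅basilica, basilica⁆ : Subgroup (AutT 2)) := by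
  intro k hk
  refine ⟨pair (k 0) (k 1), ⟨levHom_mem_levelStab _, pair_mem_commutator (hk 0) (hk 1)⟩, ?_⟩
  intro x
  refine (sectionAt_levHom _ rfl).trans ?_
  fin_cases x
  · exact if_pos rfl
  · exact if_neg (by decide)

theorem genC_ne_one : genC ≠ 1 := by
  intro h
  have h2 : act genC [0, 0] = [0, 1] := by
    rw [genC_eq, act_pair_zero, act_genB_zero]
  rw [h, act_one] at h2
  exact absurd h2 (by decide)

theorem isSelfSimilar_basilica : IsSelfSimilar basilica := by
  -- Both generators at once, since the section at 1 of either is the other.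
  have hA : ∀ v, sectionAt genA v ∈ basilica ∧ sectionAt genB v ∈ basilica := by
    intro v
    induction v with
    | nil => exact ⟨by rw [sectionAt_nil]; exact genA_mem, by rw [sectionAt_nil]; exact genB_mem⟩
    | cons x v ih =>
      rw [← List.singleton_append, sectionAt_append, sectionAt_append]
      have e0 : sectionAt genA [0] = 1 := act_ext fun u => (act_sectionAt_eq_iff _).2 rfl
      have e1 : sectionAt genA [1] = genB := act_ext fun u => (act_sectionAt_eq_iff _).2 rfl
      have e2 : sectionAt genB [0] = 1 := act_ext fun u => (act_sectionAt_eq_iff _).2 rfl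
      have e3 : sectionAt genB [1] = genA := act_ext fun u => (act_sectionAt_eq_iff _).2 rfl
      fin_cases x
      · change sectionAt (sectionAt genA [0]) v ∈ _ ∧ sectionAt (sectionAt genB [0]) v ∈ _
        rw [e0, e2, sectionAt_one]
        exact ⟨basilica.one_mem, basilica.one_mem⟩
      · change sectionAt (sectionAt genA [1]) v ∈ _ ∧ sectionAt (sectionAt genB [1]) v ∈ _
        rw [e1, e3]
        exact ih.symm
  intro g hg
  induction hg using Subgroup.closure_induction with
  | mem g hg =>
    rcases hg with rfl | rfl
    exacts [fun v => (hA v).1, fun v => (hA v).2]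
  | one => exact fun v => by rw [sectionAt_one]; exact basilica.one_mem
  | mul g h _ _ ihg ihh =>
    intro v
    rw [sectionAt_mul]
    exact basilica.mul_mem (ihg _) (ihh _)
  | inv g _ ihg => exact fun v => by rw [sectionAt_inv]; exact basilica.inv_mem (ihg _)

/-- `genB` turns a first letter 0 into 1 and keeps the rest; below the vertex 1 every element is
available by `exists_pair_mem`. -/
theorem exists_act_eq_replicate (u : List (Fin 2)) :
    ∃ g ∈ basilica, act g u = List.replicate u.length 1 := by
  suffices H : ∀ n, ∀ u : List (Fin 2), u.length = n →
      ∃ g ∈ basilica, act g u = List.replicate n 1 from H _ u rfl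
  intro n
  induction n with
  | zero => exact fun u hu => ⟨1, basilica.one_mem, List.length_eq_zero_iff.1 hu⟩
  | succ n ih =>
    have hone : ∀ u : List (Fin 2), u.length = n →
        ∃ g ∈ basilica, act g (1 :: u) = List.replicate (n + 1) 1 := by
      intro u hu
      obtain ⟨g, hg, hgu⟩ := ih u hu
      obtain ⟨x, hx⟩ := exists_pair_mem hg
      exact ⟨_, hx, by rw [act_pair_one, hgu]; rfl⟩
    rintro (_ | ⟨x, u⟩) hu
    · simp at hu
    · have hu' : u.length = n := by simpa using hu
      fin_cases x
      · obtain ⟨g, hg, hgu⟩ := hone u hu'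
        exact ⟨g * genB, basilica.mul_mem hg genB_mem, hgu⟩
      · exact hone u hu'

theorem isLevelTransitive_basilica : IsLevelTransitive basilica := by
  intro u v huv
  obtain ⟨g, hg, hgu⟩ := exists_act_eq_replicate u
  obtain ⟨h, hh, hhv⟩ := exists_act_eq_replicate v
  refine ⟨h⁻¹ * g, basilica.mul_mem (basilica.inv_mem hh) hg, ?_⟩
  rw [act_mul, hgu, act_inv_eq_iff, hhv, huv]

theorem isWeaklyRegularBranchOver_basilica :
    IsWeaklyRegularBranchOver basilica ⁅basilica, basilica⁆ where
  selfSimilar := isSelfSimilar_basilica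
  levelTransitive := isLevelTransitive_basilica
  le := Subgroup.commutator_le_self _
  ne_bot := fun h => genC_ne_one ((Subgroup.eq_bot_iff_forall _).1 h _ genC_mem)
  branching := isBranching_commutator

/-! ### Finite generation and dimension of the commutator subgroup. -/

theorem conj_mem_closure {A : Type*} [Group A] {T : Set A} {g : A}
    (h : ∀ t ∈ T, g * t * g⁻¹ ∈ Subgroup.closure T) :
    ∀ x ∈ Subgroup.closure T, g * x * g⁻¹ ∈ Subgroup.closure T := by
  have : Subgroup.closure T ≤ (Subgroup.closure T).comap (MulAut.conj g).toMonoidHom :=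
    (Subgroup.closure_le _).2 h
  exact this

theorem conj_mem_closure_of_generators {A : Type*} [Group A] {S T : Set A}
    (h : ∀ s ∈ S, ∀ t ∈ T, s * t * s⁻¹ ∈ Subgroup.closure T)
    (h' : ∀ s ∈ S, ∀ t ∈ T, s⁻¹ * t * s ∈ Subgroup.closure T) :
    ∀ g ∈ Subgroup.closure S, ∀ x ∈ Subgroup.closure T, g * x * g⁻¹ ∈ Subgroup.closure T := by
  suffices H : ∀ g ∈ Subgroup.closure S, (∀ x ∈ Subgroup.closure T,
      g * x * g⁻¹ ∈ Subgroup.closure T) ∧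
      ∀ x ∈ Subgroup.closure T, g⁻¹ * x * g⁻¹⁻¹ ∈ Subgroup.closure T from fun g hg => (H g hg).1
  intro g hg
  induction hg using Subgroup.closure_induction with
  | mem s hs => exact ⟨conj_mem_closure (h s hs), conj_mem_closure (by simpa using h' s hs)⟩
  | one => simp
  | mul a b _ _ iha ihb =>
    refine ⟨fun x hx => ?_, fun x hx => ?_⟩
    · have := iha.1 _ (ihb.1 x hx)
      simpa [mul_assoc] using this
    · have := ihb.2 _ (iha.2 x hx)
      simpa [mul_assoc] using this
  | inv a _ iha => exact ⟨iha.2, by simpa using iha.1⟩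

/-- The three elements lie in the commutator subgroup, and their conjugates by `genA`, `genB` and
the inverses are words in them, so `commutator_basilica_le` applies. -/
theorem commutator_basilica_eq_closure : (⁅basilica, basilica⁆ : Subgroup (AutT 2)) =
    Subgroup.closure {genC, pair genC 1, pair 1 genC} := by
  set F := Subgroup.closure {genC, pair genC 1, pair 1 genC} with hF
  have h1 : genC ∈ F := Subgroup.subset_closure (by simp)
  have h2 : pair genC 1 ∈ F := Subgroup.subset_closure (by simp)
  have h3 : pair 1 genC ∈ F := Subgroup.subset_closure (by simp)
  apply le_antisymm
  · refine commutator_basilica_le (conj_mem_closure_of_generators ?_ ?_) h1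
    · rintro s (rfl | rfl) t (rfl | rfl | rfl)
      · change genA * genC * genA⁻¹ ∈ F
        rwa [genA_conj_genC]
      · have e : genA * pair genC 1 * genA⁻¹ = pair genC 1 := by
          rw [genA_eq, pair_inv, pair_mul, pair_mul]; congr 1; group
        change genA * pair genC 1 * genA⁻¹ ∈ F
        rwa [e]
      -- a = (1, b) and c⁻¹ = (b⁻¹, b) conjugate (1, c) alike, having the same second coordinate.
      · have e : genA * pair 1 genC * genA⁻¹ = genC⁻¹ * pair 1 genC * genC⁻¹⁻¹ := by
          rw [genC_inv, pair_inv, genA_eq, pair_inv]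
          simp only [pair_mul]
          congr 1
          group
        change genA * pair 1 genC * genA⁻¹ ∈ F
        rw [e]
        exact F.mul_mem (F.mul_mem (F.inv_mem h1) h3) (F.inv_mem (F.inv_mem h1))
      -- Conjugation by b sends (b, b⁻¹) to (a b⁻¹ a⁻¹, b), where a b⁻¹ a⁻¹ = c⁻¹ b⁻¹.
      · have e : genB * genC * genB⁻¹ = (pair genC 1)⁻¹ * genC⁻¹ := by
          have e' : genA * genB⁻¹ * genA⁻¹ = (genA * genB * genA⁻¹)⁻¹ := by group
          rw [genC_inv, genC_eq, genB_conj, e', genA_conj_genB, ← genC_eq, pair_inv, pair_mul,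
            mul_inv_rev, inv_one, one_mul]
        change genB * genC * genB⁻¹ ∈ F
        rw [e]
        exact F.mul_mem (F.inv_mem h2) (F.inv_mem h1)
      · change genB * pair genC 1 * genB⁻¹ ∈ F
        rwa [genB_conj, mul_one, mul_inv_cancel]
      · change genB * pair 1 genC * genB⁻¹ ∈ F
        rwa [genB_conj, genA_conj_genC]
    · rintro s (rfl | rfl) t (rfl | rfl | rfl)
      · change genA⁻¹ * genC * genA ∈ F
        rwa [inv_genA_conj_genC]
      · have e : genA⁻¹ * pair genC 1 * genA = pair genC 1 := by
          rw [genA_eq, pair_inv, pair_mul, pair_mul]; congr 1; group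
        change genA⁻¹ * pair genC 1 * genA ∈ F
        rwa [e]
      · have e : genA⁻¹ * pair 1 genC * genA = genC * pair 1 genC * genC⁻¹ := by
          have h := pair_conj genB genB⁻¹ 1 genC
          rw [← genC_eq] at h
          rw [h, genA_eq, pair_inv, pair_mul, pair_mul]
          congr 1; group
        change genA⁻¹ * pair 1 genC * genA ∈ F
        rw [e]
        exact F.mul_mem (F.mul_mem h1 h3) (F.inv_mem h1)
      · have e : genB⁻¹ * genC * genB = genC⁻¹ * (pair 1 genC)⁻¹ := by
          have h := inv_genB_conj genB genB⁻¹
          rw [← genC_eq, inv_genA_conj_genB] at h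
          have h' := pair_mul genB⁻¹ genB 1 genC⁻¹
          rw [← genC_inv, mul_one] at h'
          rw [h, pair_inv, inv_one, h']
        change genB⁻¹ * genC * genB ∈ F
        rw [e]
        exact F.mul_mem (F.inv_mem h1) (F.inv_mem h3)
      · change genB⁻¹ * pair genC 1 * genB ∈ F
        rwa [inv_genB_conj, inv_genA_conj_genC]
      · change genB⁻¹ * pair 1 genC * genB ∈ F
        rwa [inv_genB_conj, mul_one, inv_mul_cancel]
  · rw [hF, Subgroup.closure_le]
    have hc1 := pair_mem_commutator genC_mem (Subgroup.one_mem _)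
    rintro t (rfl | rfl | rfl)
    exacts [genC_mem, hc1, pair_one_genC_mem]

theorem fg_commutator_basilica : (⁅basilica, basilica⁆ : Subgroup (AutT 2)).FG :=
  (Subgroup.fg_iff _).2 ⟨_, commutator_basilica_eq_closure.symm, Set.toFinite _⟩

theorem normal_commutator_basilica :
    ((⁅basilica, basilica⁆ : Subgroup (AutT 2)).subgroupOf basilica).Normal where
  conj_mem _ hk g := conj_mem_commutator g.2 hk

/-- Growth passes here from the commutator subgroup, which is branching, up to the finitely
generated group. -/
theorem hdim_commutator_basilica : hdim basilica.topologicalClosure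
    (⁅basilica, basilica⁆ : Subgroup (AutT 2)).topologicalClosure = 1 := by
  have hW := isWeaklyRegularBranchOver_basilica
  obtain ⟨c, hc, -, hcl⟩ := hW.branching.exists_growth le_rfl hW.ne_bot
  have hfg : basilica.FG := (Subgroup.fg_iff _).2 ⟨_, rfl, Set.toFinite _⟩
  refine hdim_eq_of_tendsto le_rfl (Subgroup.topologicalClosure_mono hW.le) hc ?_ ?_
  · simpa only [logCard_topologicalClosure] using (tendsto_logCard_commutator le_rfl hfg).1 hcl
  · simpa only [logCard_topologicalClosure, one_mul] using hcl

end RegTree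

theorem mainTheorem6 :
    (∀ m : ℕ, 2 ≤ m → ∀ G K : Subgroup (RegTree.AutT m),
      RegTree.IsWeaklyRegularBranchOver G K →
      K.FG →
      (K.subgroupOf G).Normal →
      RegTree.hdim G.topologicalClosure K.topologicalClosure = 1 →
      RegTree.HasCompleteBoundedSpectrum G.topologicalClosure) ∧
    (RegTree.IsWeaklyRegularBranchOver RegTree.basilica ⁅RegTree.basilica, RegTree.basilica⁆ ∧
      (⁅RegTree.basilica, RegTree.basilica⁆ : Subgroup (RegTree.AutT 2)).FG ∧
      ((⁅RegTree.basilica, RegTree.basilica⁆ : Subgroup (RegTree.AutT 2)).subgroupOf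
        RegTree.basilica).Normal ∧
      RegTree.hdim RegTree.basilica.topologicalClosure
        (⁅RegTree.basilica, RegTree.basilica⁆ : Subgroup (RegTree.AutT 2)).topologicalClosure = 1 ∧
      RegTree.HasCompleteBoundedSpectrum RegTree.basilica.topologicalClosure) :=
  ⟨fun _ hm _ _ hG hfg hn hdim => RegTree.hasCompleteBoundedSpectrum_of_branch hm hG hfg hn hdim,
    RegTree.isWeaklyRegularBranchOver_basilica, RegTree.fg_commutator_basilica,
    RegTree.normal_commutator_basilica, RegTree.hdim_commutator_basilica,
    RegTree.hasCompleteBoundedSpectrum_of_branch le_rfl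
      RegTree.isWeaklyRegularBranchOver_basilica RegTree.fg_commutator_basilica
      RegTree.normal_commutator_basilica RegTree.hdim_commutator_basilica⟩
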